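/- Let $n\ge 0$ and let $B_n$ be the group of signed permutations: bijections $w$ of $[-n,n]\setminus\{0\}$ with $w(-i)=-w(i)$, under composition. It is generated by $s_0=(-1,1)$ and $s_i=(i,i+1)(-i,-i-1)$, $1\le i\le n-1$ (for $n=0$ there are no generators). Let $B_n$ act linearly on $\mathbb R^n$ by $w\,e_i=e_{w(i)}$, where $e_{-i}:=-e_i$; put $\alpha_0=e_1$ and $\alpha_i=e_{i+1}-e_i$ for $1\le i\le n-1$, and let $\Phi=\{w\alpha_i\}$ be the resulting root system, $\Phi^+$ the set of roots that are nonnegative combinations of the $\alpha_i$, and $\Phi^-=-\Phi^+$. For a root $\beta=w\alpha_i$ let $t_\beta=w s_i w^{-1}$ be the corresponding reflection. The depth of $\beta\in\Phi^+$ is $\mathrm{dp}(\beta)=\min\{r : s_{i_1}\cdots s_{i_r}\beta\in\Phi^-\text{ for some generators } s_{i_j}\}$, and the depth of $w\in B_n$ is $$\mathrm{dp}(w)=\min\Big\{\sum_{j=1}^r \mathrm{dp}(\beta_j) : w=t_{\beta_1}\cdots t_{\beta_r},\ r\ge 0,\ \beta_j\in\Phi^+\Big\}.$$ For $u\in B_k$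 and $v\in B_l$ the direct sum $u\oplus v\in B_{k+l}$ is given by $(u\oplus v)(i)=u(i)$ for $1\le i\le k$ and $(u\oplus v)(i)=\operatorname{sign}(v(i-k))\,(|v(i-k)|+k)$ for $k<i\le k+l$. Every $w\in B_n$ is in a unique way a direct sum $w^1\oplus\cdots\oplus w^m$ of elements $w^j\in B_{n_j}$, $n_j\ge 1$, none of which is a direct sum of two signed permutations of positive size; the $w^j$ are the blocks of $w$. Let $o^B(w)$ be the number of blocks $w^j$ that have an odd number of negative entries among $w^j(1),\dots,w^j(n_j)$. Let $\mathrm{Neg}(w)=\{i\in\{1,\dots,n\} : w(i)<0\}$ and $\mathrm{neg}(w)=\#\mathrm{Neg}(w)$. **Theorem.** For every $w\in B_n$, $$\mathrm{dp}(w)=\sum_{\substack{1\le i\le n\\ w(i)>i}}\bigl(w(i)-i\bigr)+\sum_{i\in\mathrm{Neg}(w)}|w(i)|+\frac{o^B(w)-\mathrm{neg}(w)}{2},$$ and equivalently $$\mathrm{dp}(w)=\frac12\Big(\sum_{\substack{i\in[-n,n]\setminus\{0\}\\ w(i)>i}}\bigl(w(i)-i\bigr)+o^B(w)-\mathrm{neg}(w)\Big).$$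 -/

import Mathlib

namespace TypeB

/-! ## The group of signed permutations -/

/-- The set `[-n, n] \ {0}` of integers. -/
abbrev Idx (n : ℕ) : Type :=
  {x : ℤ // x ∈ (Finset.Icc (-(n : ℤ)) (n : ℤ)).erase 0}

theorem mem_idx {n : ℕ} {x : ℤ} :
    x ∈ (Finset.Icc (-(n : ℤ)) (n : ℤ)).erase 0 ↔ x ≠ 0 ∧ |x| ≤ n := by
  simp [abs_le]

instance instNegIdx (n : ℕ) : Neg (Idx n) :=
  ⟨fun x => ⟨-x.1, by have := mem_idx.1 x.2; exact mem_idx.2 (by simpa using this)⟩⟩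

theorem neg_val {n : ℕ} (x : Idx n) : (-x).1 = -x.1 := rfl

theorem neg_neg_idx {n : ℕ} (x : Idx n) : -(-x) = x := Subtype.ext (by simp [neg_val])

/-- The group `B_n` of bijections `w` of `[-n, n] \ {0}` with `w (-i) = - w i`,
under composition. -/
def signedPerms (n : ℕ) : Subgroup (Equiv.Perm (Idx n)) where
  carrier := {w | ∀ i, w (-i) = -w i}
  one_mem' := fun _ => rfl
  mul_mem' := by
    intro a b ha hb i
    simp only [Equiv.Perm.mul_apply]
    rw [hb i, ha (b i)]
  inv_mem' := by
    intro a ha i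
    rw [Equiv.Perm.inv_eq_iff_eq, ha]
    simp

/-- The type of signed permutations of `[n]`. -/
abbrev SignedPerm (n : ℕ) : Type := signedPerms n

theorem map_neg {n : ℕ} (w : SignedPerm n) (i : Idx n) : w.1 (-i) = -w.1 i := w.2 i

/-- The positive index `i + 1`, for `i = 0, …, n - 1`; thus `Fin n` enumerates `[n]`. -/
def pos {n : ℕ} (i : Fin n) : Idx n :=
  ⟨(i : ℤ) + 1, mem_idx.2 ⟨by omega, by rw [abs_of_nonneg (by omega)]; omega⟩⟩

/-- Window notation: `window w i` is the entry of `w` in the position `i + 1 ∈ [n]`. -/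
def window {n : ℕ} (w : SignedPerm n) (i : Fin n) : ℤ := (w.1 (pos i)).1

/-- The set `Neg(w)` of positions in `[n]` with a negative entry. -/
def negSet {n : ℕ} (w : SignedPerm n) : Finset (Fin n) :=
  Finset.univ.filter fun i => window w i < 0

/-- `neg(w)`, the number of negative entries. -/
def neg {n : ℕ} (w : SignedPerm n) : ℕ := (negSet w).card

/-! ## The Coxeter generators -/

theorem swap_neg {n : ℕ} (a b x : Idx n) :
    Equiv.swap (-a) (-b) (-x) = -Equiv.swap a b x := by
  have hinj : Function.Injective (fun y : Idx n => -y) := fun y z h => by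
    have := congrArg (fun y : Idx n => -y) h
    simpa [neg_neg_idx] using this
  exact hinj.swap_apply a b x

/-- The sign change `(-a, a)` in cycle notation, for the positive index `a = i + 1`. -/
def signChange {n : ℕ} (i : Fin n) : SignedPerm n :=
  ⟨Equiv.swap (-pos i) (pos i), fun x => by
    have := swap_neg (pos i) (-pos i) x
    rw [neg_neg_idx, Equiv.swap_comm (pos i)] at this
    exact this⟩

/-- The signed permutation `(a, b)(-a, -b)` in cycle notation,
for different positive indices `a = i + 1` and `b = j + 1`. -/
def doubleSwap {n : ℕ} (i j : Fin n) (hij : i ≠ j) : SignedPerm n :=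
  ⟨Equiv.swap (pos i) (pos j) * Equiv.swap (-pos i) (-pos j), by
    have hc : Equiv.swap (pos i) (pos j) * Equiv.swap (-pos i) (-pos j)
        = Equiv.swap (-pos i) (-pos j) * Equiv.swap (pos i) (pos j) := by
      apply (Equiv.Perm.disjoint_swap_swap ?_).commute
      have hij' : (i : ℕ) ≠ j := fun h => hij (Fin.ext h)
      simp only [List.nodup_cons, List.mem_cons, Subtype.ext_iff, neg_val, pos,
        List.not_mem_nil, not_false_eq_true, List.nodup_nil, or_false, and_true]
      omega
    intro x
    have h1 := swap_neg (pos i) (pos j)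
    have h2 := swap_neg (-pos i) (-pos j)
    simp only [neg_neg_idx] at h2
    conv_lhs => rw [hc]
    rw [Equiv.Perm.mul_apply, Equiv.Perm.mul_apply, h2, h1]⟩

/-- The Coxeter generators `S_B = {s_0, s_1, …, s_{n-1}}`: the generator `s_0 = (-1, 1)` changes
the sign of the entry in position `1`, and `s_i = (i, i+1)(-i, -i-1)` for `1 ≤ i ≤ n - 1`. -/
def simple {n : ℕ} (i : Fin n) : SignedPerm n :=
  if h : (i : ℕ) = 0 then signChange i
  else doubleSwap ⟨(i : ℕ) - 1, by omega⟩ i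
    (fun he => by have := congrArg Fin.val he; simp only at this; omega)

/-! ## The root system -/

/-- The vector `e_x` of `ℝⁿ` for `x ∈ [-n, n] \ {0}`: the standard basis vector for `x > 0`, and
`e_{-x} = -e_x`. -/
noncomputable def basisVec {n : ℕ} (x : Idx n) : Fin n → ℝ :=
  fun j => if x = pos j then 1 else if x = -pos j then -1 else 0

/-- The reflection representation of `B_n` on `ℝⁿ`: the linear action with `w e_i = e_{w(i)}`. -/
noncomputable def act {n : ℕ} (w : SignedPerm n) (v : Fin n → ℝ) : Fin n → ℝ :=
  ∑ i, v i • basisVec (w.1 (pos i))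

/-- The simple roots `Π`: `α_0 = e_1`, and `α_i = e_{i+1} - e_i` for `1 ≤ i ≤ n - 1`. -/
noncomputable def simpleRoot {n : ℕ} (i : Fin n) : Fin n → ℝ :=
  if (i : ℕ) = 0 then basisVec (pos i)
  else basisVec (pos i) - basisVec (pos ⟨(i : ℕ) - 1, by omega⟩)

/-- The root system `Φ` of `(B_n, S_B)`: the images of the simple roots under the group. -/
def roots (n : ℕ) : Set (Fin n → ℝ) :=
  {β | ∃ (w : SignedPerm n) (i : Fin n), β = act w (simpleRoot i)}

/-- The positive roots `Φ⁺`: the roots that are nonnegative combinations of simple roots. -/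
def posRoots (n : ℕ) : Set (Fin n → ℝ) :=
  {β | β ∈ roots n ∧ ∃ c : Fin n → ℝ, (∀ i, 0 ≤ c i) ∧ β = ∑ i, c i • simpleRoot i}

/-- The negative roots `Φ⁻`. -/
def negRoots (n : ℕ) : Set (Fin n → ℝ) := {β | β ∈ roots n ∧ -β ∈ posRoots n}

/-- `IsReflectionOf β t` says that `β` is a root and that `t` is the corresponding reflection
`t_β`: if `β = w α_i`, then `t_β = w s_i w⁻¹`. -/
def IsReflectionOf {n : ℕ} (β : Fin n → ℝ) (t : SignedPerm n) : Prop :=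
  ∃ (w : SignedPerm n) (i : Fin n), β = act w (simpleRoot i) ∧ t = w * simple i * w⁻¹

/-! ## Depth -/

/-- The depth of a positive root `β`: the least `r` such that `s_{i_1} ⋯ s_{i_r} β` is a negative
root for some generators `s_{i_1}, …, s_{i_r}`. -/
noncomputable def rootDepth {n : ℕ} (β : Fin n → ℝ) : ℕ :=
  sInf {r | ∃ l : List (Fin n), l.length = r ∧ act (l.map simple).prod β ∈ negRoots n}

/-- The depth of `w`: the least value of `dp(β_1) + ⋯ + dp(β_r)` over all factorizations
`w = t_{β_1} ⋯ t_{β_r}` into reflections, where the `β_j` are positive roots. A factorization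
is given as the list of the pairs `(β_j, t_{β_j})`. -/
noncomputable def depth {n : ℕ} (w : SignedPerm n) : ℕ :=
  sInf {d | ∃ F : List ((Fin n → ℝ) × SignedPerm n),
    (∀ p ∈ F, p.1 ∈ posRoots n ∧ IsReflectionOf p.1 p.2) ∧
    (F.map Prod.snd).prod = w ∧ (F.map fun p => rootDepth p.1).sum = d}

/-! ## Direct sums, blocks and oddness -/

/-- The map `y ↦ sign(y) (|y| + k)`. -/
def shift (k : ℕ) (y : ℤ) : ℤ := y.sign * (|y| + k)

theorem shift_neg (k : ℕ) (y : ℤ) : shift k (-y) = -shift k y := by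
  simp [shift]

theorem shift_of_pos (k : ℕ) {y : ℤ} (h : 0 < y) : shift k y = y + k := by
  simp [shift, Int.sign_eq_one_of_pos h, abs_of_pos h]

theorem shift_of_neg (k : ℕ) {y : ℤ} (h : y < 0) : shift k y = y - k := by
  simp [shift, Int.sign_eq_neg_one_of_neg h, abs_of_neg h]; ring

/-- The inclusion of `[-k, k] \ {0}` into `[-(k+l), k+l] \ {0}`. -/
def low (k l : ℕ) (x : Idx k) : Idx (k + l) :=
  ⟨x.1, by
    have h := mem_idx.1 x.2
    exact mem_idx.2 ⟨h.1, by push_cast; omega⟩⟩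

/-- The map `y ↦ sign(y) (|y| + k)` from `[-l, l] \ {0}` to `[-(k+l), k+l] \ {0}`. -/
def high (k l : ℕ) (y : Idx l) : Idx (k + l) :=
  ⟨shift k y.1, by
    have h := mem_idx.1 y.2
    refine mem_idx.2 ?_
    have h2 := abs_le.1 h.2
    rcases lt_or_gt_of_ne h.1 with h1 | h1
    · rw [shift_of_neg k h1, abs_of_neg (by omega)]; push_cast; omega
    · rw [shift_of_pos k h1, abs_of_pos (by omega)]; push_cast; omega⟩

theorem split_bijective (k l : ℕ) : Function.Bijective (Sum.elim (low k l) (high k l)) := by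
  have key : ∀ y : Idx l, (0 < y.1 ∧ (high k l y).1 = y.1 + k) ∨
      (y.1 < 0 ∧ (high k l y).1 = y.1 - k) := fun y => by
    rcases lt_or_gt_of_ne (mem_idx.1 y.2).1 with h1 | h1
    · exact Or.inr ⟨h1, shift_of_neg k h1⟩
    · exact Or.inl ⟨h1, shift_of_pos k h1⟩
  have hlow : ∀ x : Idx k, (low k l x).1 = x.1 := fun _ => rfl
  constructor
  · rintro (x | x) (y | y) h <;> simp only [Sum.elim_inl, Sum.elim_inr, Subtype.ext_iff] at h
    · exact congrArg _ (Subtype.ext h)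
    · have := abs_le.1 (mem_idx.1 x.2).2
      rcases key y with h' | h' <;> rw [h'.2, hlow] at h <;> omega
    · have := abs_le.1 (mem_idx.1 y.2).2
      rcases key x with h' | h' <;> rw [h'.2, hlow] at h <;> omega
    · refine congrArg _ (Subtype.ext ?_)
      rcases key x with h1 | h1 <;> rcases key y with h2 | h2 <;>
        rw [h1.2, h2.2] at h <;> omega
  · intro z
    have hz := mem_idx.1 z.2
    have hz2 := abs_le.1 hz.2
    push_cast at hz2
    by_cases h : |z.1| ≤ k
    · exact ⟨Sum.inl ⟨z.1, mem_idx.2 ⟨hz.1, h⟩⟩, rfl⟩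
    · rcases lt_or_gt_of_ne hz.1 with h1 | h1
      · rw [abs_of_neg h1] at h
        refine ⟨Sum.inr ⟨z.1 + k, mem_idx.2 ⟨by omega, abs_le.2 ⟨by omega, by omega⟩⟩⟩,
          Subtype.ext ?_⟩
        exact (shift_of_neg k (show z.1 + k < 0 by omega)).trans (by ring)
      · rw [abs_of_pos h1] at h
        refine ⟨Sum.inr ⟨z.1 - k, mem_idx.2 ⟨by omega, abs_le.2 ⟨by omega, by omega⟩⟩⟩,
          Subtype.ext ?_⟩
        exact (shift_of_pos k (show 0 < z.1 - k by omega)).trans (by ring)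

/-- The index set of `B_{k+l}` as the disjoint union of those of `B_k` and (shifted) `B_l`. -/
noncomputable def split (k l : ℕ) : Idx k ⊕ Idx l ≃ Idx (k + l) :=
  Equiv.ofBijective _ (split_bijective k l)

/-- The direct sum `u ⊕ v` of `u ∈ B_k` and `v ∈ B_l`. Its values are computed in
`directSum_low` and `directSum_high`. -/
noncomputable def directSum {k l : ℕ} (u : SignedPerm k) (v : SignedPerm l) :
    SignedPerm (k + l) :=
  ⟨(split k l).permCongr (Equiv.Perm.sumCongr u.1 v.1), by
    intro x
    obtain ⟨y | y, rfl⟩ := (split k l).surjective x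
    · have h : -(split k l (Sum.inl y)) = split k l (Sum.inl (-y)) := rfl
      rw [h]
      simp only [Equiv.permCongr_apply, Equiv.symm_apply_apply, Equiv.Perm.sumCongr_apply,
        Sum.map_inl, map_neg]
      rfl
    · have h (z : Idx l) : split k l (Sum.inr (-z)) = -(split k l (Sum.inr z)) :=
        Subtype.ext (shift_neg k z.1)
      rw [← h]
      simp only [Equiv.permCongr_apply, Equiv.symm_apply_apply, Equiv.Perm.sumCongr_apply,
        Sum.map_inr, map_neg]
      exact h _⟩

/-- `(u ⊕ v)(x) = u(x)` for `|x| ≤ k`. -/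
theorem directSum_low {k l : ℕ} (u : SignedPerm k) (v : SignedPerm l) (x : Idx k) :
    (directSum u v).1 (low k l x) = low k l (u.1 x) := by
  have h (z : Idx k) : low k l z = split k l (Sum.inl z) := rfl
  rw [h, h]
  simp [directSum, Equiv.permCongr_apply]

/-- `(u ⊕ v)(y + k) = sign(v(y)) (|v(y)| + k)` for `y > 0`, extended to `y < 0` by oddness. -/
theorem directSum_high {k l : ℕ} (u : SignedPerm k) (v : SignedPerm l) (y : Idx l) :
    (directSum u v).1 (high k l y) = high k l (v.1 y) := by
  have h (z : Idx l) : high k l z = split k l (Sum.inr z) := rfl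
  rw [h, h]
  simp [directSum, Equiv.permCongr_apply]

/-- A signed permutation of some `[n]`. -/
abbrev AnySignedPerm : Type := Σ n : ℕ, SignedPerm n

/-- The direct sum `w¹ ⊕ ⋯ ⊕ w^k` of a list of signed permutations. -/
noncomputable def listSum : List AnySignedPerm → AnySignedPerm
  | [] => ⟨0, 1⟩
  | b :: L => ⟨b.1 + (listSum L).1, directSum b.2 (listSum L).2⟩

/-- `w ∈ B_n` is decomposable if it is a direct sum of elements of `B_k` and `B_{n-k}` with
`1 ≤ k ≤ n - 1`. -/
def Decomposable (w : AnySignedPerm) : Prop :=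
  ∃ (k l : ℕ) (u : SignedPerm k) (v : SignedPerm l),
    1 ≤ k ∧ 1 ≤ l ∧ w = ⟨k + l, directSum u v⟩

/-- `L` is a type B decomposition of `w`: the list of indecomposable signed permutations (in `B_m`
with `m ≥ 1`), the blocks, whose direct sum is `w`. -/
def IsDecomposition {n : ℕ} (w : SignedPerm n) (L : List AnySignedPerm) : Prop :=
  (∀ b ∈ L, 1 ≤ b.1 ∧ ¬ Decomposable b) ∧ listSum L = ⟨n, w⟩

/-! The type B decomposition exists and is unique, so that the oddness is well defined. -/

theorem high_neg (k l : ℕ) (y : Idx l) : high k l (-y) = -high k l y :=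
  Subtype.ext (shift_neg k y.1)

theorem low_or_high {k l : ℕ} (x : Idx (k + l)) :
    (∃ y, x = low k l y) ∨ ∃ y, x = high k l y := by
  obtain ⟨y | y, h⟩ := (split_bijective k l).2 x
  · exact Or.inl ⟨y, h.symm⟩
  · exact Or.inr ⟨y, h.symm⟩

theorem shift_shift (k l : ℕ) (y : ℤ) : shift (k + l) y = shift k (shift l y) := by
  rcases lt_trichotomy y 0 with h | h | h
  · rw [shift_of_neg l h, shift_of_neg k (by omega), shift_of_neg _ h]; push_cast; ring
  · simp [shift, h]
  · rw [shift_of_pos l h, shift_of_pos k (by omega), shift_of_pos _ h]; push_cast; ring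

/-- The values of a signed permutation as a function on all integers (`0` off the domain). -/
noncomputable def val (a : AnySignedPerm) (x : ℤ) : ℤ :=
  if h : x ∈ (Finset.Icc (-(a.1 : ℤ)) (a.1 : ℤ)).erase 0 then (a.2.1 ⟨x, h⟩).1 else 0

theorem val_coe {n : ℕ} (w : SignedPerm n) (x : Idx n) : val ⟨n, w⟩ x.1 = (w.1 x).1 := by
  unfold val; exact dif_pos x.2

theorem any_ext {m n : ℕ} (u : SignedPerm m) (v : SignedPerm n) (h : m = n)
    (hv : ∀ x : Idx m, val ⟨m, u⟩ x.1 = val ⟨n, v⟩ x.1) :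
    (⟨m, u⟩ : AnySignedPerm) = ⟨n, v⟩ := by
  subst h
  congr 1
  refine Subtype.ext (Equiv.ext fun x => Subtype.ext ?_)
  rw [← val_coe, ← val_coe, hv]

theorem val_low {k l : ℕ} (u : SignedPerm k) (v : SignedPerm l) (x : Idx k) :
    val ⟨k + l, directSum u v⟩ x.1 = val ⟨k, u⟩ x.1 := by
  rw [val_coe u x]
  exact (val_coe (directSum u v) (low k l x)).trans (by rw [directSum_low]; rfl)

theorem val_high {k l : ℕ} (u : SignedPerm k) (v : SignedPerm l) (y : Idx l) :
    val ⟨k + l, directSum u v⟩ (shift k y.1) = shift k (val ⟨l, v⟩ y.1) := by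
  rw [val_coe v y]
  exact (val_coe (directSum u v) (high k l y)).trans (by rw [directSum_high]; rfl)

theorem directSum_assoc {k l m : ℕ} (u : SignedPerm k) (v : SignedPerm l) (z : SignedPerm m) :
    (⟨k + l + m, directSum (directSum u v) z⟩ : AnySignedPerm) =
      ⟨k + (l + m), directSum u (directSum v z)⟩ := by
  refine any_ext _ _ (Nat.add_assoc k l m) fun x => ?_
  rcases low_or_high x with ⟨x, rfl⟩ | ⟨c, rfl⟩
  · rw [show (low (k + l) m x).1 = x.1 from rfl, val_low]
    rcases low_or_high x with ⟨a, rfl⟩ | ⟨b, rfl⟩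
    · rw [show (low k l a).1 = a.1 from rfl, val_low, val_low]
    · rw [show (high k l b).1 = shift k b.1 from rfl, val_high,
        show b.1 = (low l m b).1 from rfl, val_high]
      rw [show (low l m b).1 = b.1 from rfl, val_low]
  · rw [show (high (k + l) m c).1 = shift (k + l) c.1 from rfl, val_high, shift_shift,
      shift_shift k l c.1, show shift l c.1 = (high l m c).1 from rfl, val_high,
      show (high l m c).1 = shift l c.1 from rfl, val_high]

theorem zero_directSum {l : ℕ} (u : SignedPerm 0) (v : SignedPerm l) :
    (⟨0 + l, directSum u v⟩ : AnySignedPerm) = ⟨l, v⟩ := by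
  have h0 (y : ℤ) : shift 0 y = y := by simp [shift, Int.sign_mul_abs]
  refine any_ext _ _ (Nat.zero_add l) fun x => ?_
  rcases low_or_high x with ⟨x, rfl⟩ | ⟨c, rfl⟩
  · have := mem_idx.1 x.2
    exact absurd (abs_nonpos_iff.1 (by simpa using this.2)) this.1
  · rw [show (high 0 l c).1 = shift 0 c.1 from rfl, val_high, h0, h0]

theorem signedPerm_zero (w : SignedPerm 0) : w = 1 := by
  refine Subtype.ext (Equiv.ext fun x => ?_)
  have := mem_idx.1 x.2
  exact absurd (abs_nonpos_iff.1 (by simpa using this.2)) this.1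

theorem directSum_zero {k : ℕ} (u : SignedPerm k) (v : SignedPerm 0) :
    (⟨k + 0, directSum u v⟩ : AnySignedPerm) = ⟨k, u⟩ := by
  refine any_ext _ _ (Nat.add_zero k) fun x => ?_
  rcases low_or_high x with ⟨x, rfl⟩ | ⟨c, rfl⟩
  · exact val_low u v x
  · have := mem_idx.1 c.2
    exact absurd (abs_nonpos_iff.1 (by simpa using this.2)) this.1

theorem listSum_append (L M : List AnySignedPerm) :
    listSum (L ++ M) = ⟨(listSum L).1 + (listSum M).1,
      directSum (listSum L).2 (listSum M).2⟩ := by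
  induction L with
  | nil => exact (zero_directSum _ _).symm
  | cons b L ih =>
    rw [List.cons_append, listSum, ih]
    exact (directSum_assoc _ _ _).symm

theorem exists_decomposition {n : ℕ} (w : SignedPerm n) :
    ∃ L : List AnySignedPerm, IsDecomposition w L := by
  induction n using Nat.strong_induction_on with
  | _ n ih =>
    rcases Nat.eq_zero_or_pos n with rfl | hn
    · exact ⟨[], by simp, by rw [signedPerm_zero w]; rfl⟩
    by_cases h : Decomposable ⟨n, w⟩
    · obtain ⟨k, l, u, v, hk, hl, h⟩ := h
      cases h
      obtain ⟨L, hL, hL'⟩ := ih k (by omega) u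
      obtain ⟨M, hM, hM'⟩ := ih l (by omega) v
      refine ⟨L ++ M, fun b hb => ?_, ?_⟩
      · rcases List.mem_append.1 hb with hb | hb
        · exact hL b hb
        · exact hM b hb
      · rw [listSum_append, hL', hM']
    · exact ⟨[⟨n, w⟩], fun b hb => by rw [List.mem_singleton.1 hb]; exact ⟨hn, h⟩,
        directSum_zero w 1⟩

theorem directSum_injective {k l : ℕ} {u u' : SignedPerm k} {v v' : SignedPerm l}
    (h : directSum u v = directSum u' v') : u = u' ∧ v = v' := by
  have hinj := (split_bijective k l).1
  constructor
  · refine Subtype.ext (Equiv.ext fun x => ?_)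
    have := directSum_low u v x
    rw [h, directSum_low] at this
    exact (Sum.inl_injective (hinj this)).symm
  · refine Subtype.ext (Equiv.ext fun x => ?_)
    have := directSum_high u v x
    rw [h, directSum_high] at this
    exact (Sum.inr_injective (hinj this)).symm

theorem exists_directSum {k l : ℕ} (w : SignedPerm (k + l))
    (h : ∀ x : Idx k, ∃ y : Idx k, w.1 (low k l x) = low k l y) :
    ∃ (u : SignedPerm k) (v : SignedPerm l), w = directSum u v := by
  obtain ⟨⟨p, q⟩, hpq⟩ := Equiv.Perm.mem_sumCongrHom_range_of_perm_mapsTo_inl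
    (σ := (split k l).symm.permCongr w.1) (by
      rintro _ ⟨x, rfl⟩
      obtain ⟨y, hy⟩ := h x
      refine ⟨y, ?_⟩
      rw [Equiv.permCongr_apply, Equiv.symm_symm, show split k l (Sum.inl x) = low k l x from rfl,
        hy, show low k l y = split k l (Sum.inl y) from rfl, Equiv.symm_apply_apply])
  have hw (s : Idx k ⊕ Idx l) : w.1 (split k l s) = split k l (Sum.map p q s) := by
    have := congrArg (fun f => split k l (f s)) hpq
    simpa [Equiv.permCongr_apply] using this.symm
  have hp (x : Idx k) : w.1 (low k l x) = low k l (p x) := hw (Sum.inl x)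
  have hq (x : Idx l) : w.1 (high k l x) = high k l (q x) := hw (Sum.inr x)
  have hinj := (split_bijective k l).1
  refine ⟨⟨p, fun x => ?_⟩, ⟨q, fun x => ?_⟩, Subtype.ext (Equiv.ext fun x => ?_)⟩
  · have h1 : low k l (p (-x)) = low k l (-p x) := by
      rw [← hp, show low k l (-x) = -low k l x from rfl, map_neg, hp]; rfl
    exact Sum.inl_injective (hinj h1)
  · have h1 : high k l (q (-x)) = high k l (-q x) := by
      rw [← hq, high_neg, map_neg, hq, high_neg]
    exact Sum.inr_injective (hinj h1)
  · rcases low_or_high x with ⟨y, rfl⟩ | ⟨y, rfl⟩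
    · rw [hp, directSum_low]
    · rw [hq, directSum_high]

theorem decomposable_of_lt {k l k' l' : ℕ} (u : SignedPerm k) (v : SignedPerm l)
    (u' : SignedPerm k') (v' : SignedPerm l') (hk : 1 ≤ k) (hlt : k < k')
    (h : (⟨k + l, directSum u v⟩ : AnySignedPerm) = ⟨k' + l', directSum u' v'⟩) :
    Decomposable ⟨k', u'⟩ := by
  obtain ⟨d, rfl⟩ := Nat.exists_eq_add_of_le hlt.le
  obtain ⟨a, b, hab⟩ := exists_directSum u' fun x => by
    refine ⟨u.1 x, Subtype.ext ?_⟩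
    have h1 := val_low u v x
    rw [h, val_coe] at h1
    have h2 := val_low u' v' (low k d x)
    rw [val_coe u'] at h2
    exact h2.symm.trans h1
  exact ⟨k, d, a, b, hk, by omega, by rw [← hab]⟩

theorem decomposition_unique {n : ℕ} {w : SignedPerm n} {L M : List AnySignedPerm}
    (hL : IsDecomposition w L) (hM : IsDecomposition w M) : L = M := by
  induction L generalizing n M with
  | nil =>
    cases M with
    | nil => rfl
    | cons c M =>
      have h := hL.2.trans hM.2.symm
      have h1 := congrArg Sigma.fst h
      have h2 := (hM.1 c (by simp)).1
      simp only [listSum] at h1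
      omega
  | cons b L ih =>
    cases M with
    | nil =>
      have h := hL.2.trans hM.2.symm
      have h1 := congrArg Sigma.fst h
      have h2 := (hL.1 b (by simp)).1
      simp only [listSum] at h1
      omega
    | cons c M =>
      have h := hL.2.trans hM.2.symm
      have hb := hL.1 b (by simp)
      have hc := hM.1 c (by simp)
      rcases lt_trichotomy b.1 c.1 with hlt | heq | hlt
      · exact absurd (decomposable_of_lt _ _ _ _ hb.1 hlt h) hc.2
      · obtain ⟨k, u⟩ := b
        obtain ⟨k', u'⟩ := c
        obtain rfl : k = k' := heq
        have hrest : u = u' ∧ listSum L = listSum M := by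
          simp only [listSum] at h
          generalize listSum L = A at h
          generalize listSum M = B at h
          obtain ⟨a, A⟩ := A
          obtain ⟨b, B⟩ := B
          have hab : k + a = k + b := congrArg Sigma.fst h
          obtain rfl : a = b := by omega
          have := directSum_injective (eq_of_heq (Sigma.mk.inj h).2)
          exact ⟨this.1, congrArg (Sigma.mk a) this.2⟩
        rw [hrest.1, ih (w := (listSum L).2) ⟨fun x hx => hL.1 x (by simp [hx]), rfl⟩
          ⟨fun x hx => hM.1 x (by simp [hx]), hrest.2.symm⟩]
      · exact absurd (decomposable_of_lt _ _ _ _ hc.1 hlt h.symm) hb.2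

/-- The type B decomposition of `w`, as the list of its blocks. -/
noncomputable def blocks {n : ℕ} (w : SignedPerm n) : List AnySignedPerm :=
  (exists_decomposition w).choose

theorem isDecomposition_iff {n : ℕ} (w : SignedPerm n) (L : List AnySignedPerm) :
    IsDecomposition w L ↔ L = blocks w :=
  ⟨fun h => decomposition_unique h (exists_decomposition w).choose_spec,
    fun h => h ▸ (exists_decomposition w).choose_spec⟩

/-- The B-oddness `o^B(w)`: the number of blocks with an odd number of negative entries. -/
noncomputable def oddness {n : ℕ} (w : SignedPerm n) : ℕ :=
  (blocks w).countP fun b => decide (Odd (neg b.2))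

end TypeB

namespace TypeB

open Finset

/-! ## Reflections as permutations of the index set -/

/-! For `k ≥ 0` let `c_k(w)` be the number of `x ≤ k` with `w(x) > k`. Cutting each interval `[x,
w(x))` into unit steps turns both sums of the statement into sums of the `c_k(w)`, and the claim
becomes `2 dp(w) = weight w`, where `weight w = c_0(w) + 2 (c_1(w) + ⋯ + c_{n-1}(w)) + o^B(w)` and
`c_0(w) = neg(w)`.

The depths of the positive roots are explicit: `i` for `e_i`, `j - i` for `e_j - e_i`, and `i + j -
1` for `e_i + e_j`. Chains of simple reflections give the upper bounds, and the linear functional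
`level` gives the lower ones. It remains to show that right multiplication by `t_β` raises the
weight by at most `2 dp(β)` (`weight_mul_le`), and that every `w ≠ 1` admits some `β` lowering the
weight by at least `2 dp(β)` (`hasDescent`).

The delicate term is the oddness, since a reflection can merge and split blocks. It is therefore
described variationally. Call `k` a cut if `w` preserves `[-k, k]`; the inner cuts are the block
boundaries. Then `o^B(w)` is the least number of changes of a sequence `ε 0, …, ε n` in `ZMod 2`
that equals, at every cut `k`, the parity of the number of negative entries in positions `1, …, k`
(`oddness_le_changes`, `exists_changes_eq_oddness`). To bound the oddness of `w t` it suffices to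
adjust an optimal `ε` for `w`. Correcting `ε` at one position costs at most two changes, which is
exactly the worth of one crossing in the weight.

For the descent, if some `w(i) > i` with `i > 0`, take `w(i)` maximal and exchange it with the
smallest entry in the positions `(i, w(i)]`. Otherwise take the most negative entry `w(i)`: if its
block is odd, change its sign; if even, exchange it with the second smallest entry, changing both
signs. -/

theorem idx_ne_zero {n : ℕ} (x : Idx n) : x.1 ≠ 0 := (mem_idx.1 x.2).1

theorem idx_le {n : ℕ} (x : Idx n) : x.1 ≤ n := (abs_le.1 (mem_idx.1 x.2).2).2

theorem neg_le_idx {n : ℕ} (x : Idx n) : -(n : ℤ) ≤ x.1 := (abs_le.1 (mem_idx.1 x.2).2).1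

theorem pos_val {n : ℕ} (i : Fin n) : (pos i).1 = (i : ℤ) + 1 := rfl

theorem exists_idx {n : ℕ} {x : ℤ} (h0 : x ≠ 0) (h : |x| ≤ n) : ∃ y : Idx n, y.1 = x :=
  ⟨⟨x, mem_idx.2 ⟨h0, h⟩⟩, rfl⟩

theorem exists_pos {n : ℕ} (x : Idx n) (h : 0 < x.1) : ∃ i : Fin n, x = pos i := by
  have := idx_le x
  exact ⟨⟨(x.1 - 1).toNat, by omega⟩, Subtype.ext (by simp only [pos]; omega)⟩

/-- The map exchanging `p` with `q` and `-p` with `-q`. -/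
def reflFun {n : ℕ} (p q x : Idx n) : Idx n :=
  if x = p then q else if x = q then p else if x = -p then -q else if x = -q then -p else x

theorem reflFun_reflFun {n : ℕ} (p q x : Idx n) : reflFun p q (reflFun p q x) = x := by
  have := idx_ne_zero p
  have := idx_ne_zero q
  unfold reflFun
  simp only [Subtype.ext_iff, neg_val, apply_ite Subtype.val]
  split_ifs <;> omega

theorem reflFun_neg {n : ℕ} (p q x : Idx n) : reflFun p q (-x) = -reflFun p q x := by
  have := idx_ne_zero p
  have := idx_ne_zero q
  unfold reflFun
  simp only [Subtype.ext_iff, neg_val, apply_ite Subtype.val]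
  split_ifs <;> omega

/-- The reflection `(p, q)(-p, -q)`, which is the sign change `(p, -p)` for `q = -p`. -/
def refl {n : ℕ} (p q : Idx n) : SignedPerm n :=
  ⟨⟨reflFun p q, reflFun p q, reflFun_reflFun p q, reflFun_reflFun p q⟩, reflFun_neg p q⟩

theorem refl_apply {n : ℕ} (p q x : Idx n) : (refl p q).1 x = reflFun p q x := rfl

theorem refl_mul_self {n : ℕ} (p q : Idx n) : refl p q * refl p q = 1 :=
  Subtype.ext (Equiv.ext fun x => reflFun_reflFun p q x)

theorem mul_val {n : ℕ} (u v : SignedPerm n) (x : Idx n) : (u * v).1 x = u.1 (v.1 x) := rfl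

theorem refl_comm {n : ℕ} (p q : Idx n) : refl p q = refl q p := by
  refine Subtype.ext (Equiv.ext fun x => ?_)
  simp only [refl_apply, reflFun, Subtype.ext_iff, neg_val, apply_ite Subtype.val]
  split_ifs <;> omega

theorem refl_neg_neg {n : ℕ} (p q : Idx n) : refl (-p) (-q) = refl p q := by
  have := idx_ne_zero p
  have := idx_ne_zero q
  refine Subtype.ext (Equiv.ext fun x => ?_)
  simp only [refl_apply, reflFun, Subtype.ext_iff, neg_val, apply_ite Subtype.val]
  split_ifs <;> omega

theorem conj_refl {n : ℕ} (w : SignedPerm n) (p q : Idx n) :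
    w * refl p q * w⁻¹ = refl (w.1 p) (w.1 q) := by
  rw [mul_inv_eq_iff_eq_mul]
  refine Subtype.ext (Equiv.ext fun x => ?_)
  simp only [mul_val, refl_apply, reflFun, ← map_neg, EmbeddingLike.apply_eq_iff_eq]
  split_ifs <;> rfl

theorem signChange_eq {n : ℕ} (i : Fin n) : signChange i = refl (pos i) (-pos i) := by
  refine Subtype.ext (Equiv.ext fun x => ?_)
  simp only [signChange, refl_apply, reflFun, Equiv.swap_apply_def, Subtype.ext_iff, neg_val,
    apply_ite Subtype.val]
  split_ifs <;> omega

theorem doubleSwap_eq {n : ℕ} (i j : Fin n) (hij : i ≠ j) :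
    doubleSwap i j hij = refl (pos j) (pos i) := by
  refine Subtype.ext (Equiv.ext fun x => ?_)
  have hij' : (i : ℕ) ≠ j := fun h => hij (Fin.ext h)
  simp only [doubleSwap, Equiv.Perm.mul_apply, refl_apply, reflFun, Equiv.swap_apply_def,
    Subtype.ext_iff, neg_val, apply_ite Subtype.val, pos_val]
  split_ifs <;> omega

theorem simple_zero {n : ℕ} (i : Fin n) (h : (i : ℕ) = 0) :
    simple i = refl (pos i) (-pos i) := by
  rw [simple, dif_pos h, signChange_eq]

theorem simple_succ {n : ℕ} (i j : Fin n) (h : (j : ℕ) = i + 1) :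
    simple j = refl (pos j) (pos i) := by
  rw [simple, dif_neg (by omega), doubleSwap_eq]
  congr
  rw [h, Nat.add_sub_cancel]

theorem exists_simple_eq {n : ℕ} (j : Fin n) :
    (j : ℕ) = 0 ∨ ∃ i : Fin n, (j : ℕ) = i + 1 := by
  rcases Nat.eq_zero_or_pos (j : ℕ) with h | h
  · exact Or.inl h
  · exact Or.inr ⟨⟨(j : ℕ) - 1, by omega⟩, by simp only; omega⟩

theorem simple_mul_self {n : ℕ} (i : Fin n) : simple i * simple i = 1 := by
  rcases exists_simple_eq i with h | ⟨j, h⟩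
  · rw [simple_zero i h, refl_mul_self]
  · rw [simple_succ j i h, refl_mul_self]

/-! ## Sums over the index set -/

theorem pos_neg_bijective (n : ℕ) :
    Function.Bijective (Sum.elim (fun i : Fin n => pos i) fun i => -pos i) := by
  constructor
  · rintro (i | i) (j | j) h <;>
      simp only [Sum.elim_inl, Sum.elim_inr, Subtype.ext_iff, neg_val, pos_val] at h
    · exact congrArg _ (Fin.ext (by omega))
    · omega
    · omega
    · exact congrArg _ (Fin.ext (by omega))
  · intro x
    rcases lt_or_gt_of_ne (idx_ne_zero x) with h | h
    · obtain ⟨i, hi⟩ := exists_pos (-x) (by rw [neg_val]; omega)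
      exact ⟨Sum.inr i, by rw [Sum.elim_inr, ← hi, neg_neg_idx]⟩
    · obtain ⟨i, hi⟩ := exists_pos x h
      exact ⟨Sum.inl i, hi.symm⟩

theorem sum_idx {n : ℕ} {M : Type*} [AddCommMonoid M] (g : Idx n → M) :
    ∑ x, g x = ∑ i, g (pos i) + ∑ i, g (-pos i) := by
  rw [← (Equiv.ofBijective _ (pos_neg_bijective n)).sum_comp, Fintype.sum_sum_type]
  rfl

/-- The sum `∑ A(x) B(w(x))` over all indices `x`. -/
noncomputable def pairing {n : ℕ} (A B : Idx n → ℤ) (w : SignedPerm n) : ℤ := ∑ x, A x * B (w.1 x)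

theorem pairing_mul_refl {n : ℕ} (A B : Idx n → ℤ) (w : SignedPerm n) (p q : Idx n) :
    pairing A B (w * refl p q) =
      pairing A B w + ∑ x, (A (reflFun p q x) - A x) * B (w.1 x) := by
  have : pairing A B (w * refl p q) = ∑ x, A (reflFun p q x) * B (w.1 x) := by
    unfold pairing
    rw [← Equiv.sum_comp (refl p q).1]
    refine Finset.sum_congr rfl fun x _ => ?_
    rw [mul_val, refl_apply, refl_apply, reflFun_reflFun]
  rw [this, pairing, ← Finset.sum_add_distrib]
  exact Finset.sum_congr rfl fun x _ => by ring

/-- Only the four indices `±p`, `±q` are moved. Crossing numbers and counts of negative entries are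
both pairings, so this formula and `pairing_mul_refl_neg` yield the effect of every reflection on
them. -/
theorem pairing_mul_refl_of_ne {n : ℕ} (A B : Idx n → ℤ) (w : SignedPerm n) {p q : Idx n}
    (h : q.1 ≠ p.1) (h' : q.1 ≠ -p.1) :
    pairing A B (w * refl p q) = pairing A B w + (A q - A p) * (B (w.1 p) - B (w.1 q)) +
      (A (-q) - A (-p)) * (B (-w.1 p) - B (-w.1 q)) := by
  have hp := idx_ne_zero p
  have hq := idx_ne_zero q
  rw [pairing_mul_refl, ← Finset.sum_subset (Finset.subset_univ {p, q, -p, -q})]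
  · rw [Finset.sum_insert, Finset.sum_insert, Finset.sum_insert, Finset.sum_singleton]
    · have h1 : reflFun p q p = q := by simp [reflFun]
      have h2 : reflFun p q q = p := by
        simp [reflFun, show q ≠ p from fun e => h (congrArg _ e)]
      rw [reflFun_neg, reflFun_neg, h1, h2, map_neg, map_neg]
      ring
    all_goals simp only [mem_insert, mem_singleton, Subtype.ext_iff, neg_val]; omega
  · intro x _ hx
    simp only [mem_insert, mem_singleton, not_or] at hx
    simp [reflFun, hx]

theorem pairing_mul_refl_neg {n : ℕ} (A B : Idx n → ℤ) (w : SignedPerm n) (p : Idx n) :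
    pairing A B (w * refl p (-p)) =
      pairing A B w + (A (-p) - A p) * (B (w.1 p) - B (-w.1 p)) := by
  have hp := idx_ne_zero p
  rw [pairing_mul_refl, ← Finset.sum_subset (Finset.subset_univ {p, -p})]
  · rw [Finset.sum_insert, Finset.sum_singleton]
    · have h1 : reflFun p (-p) p = -p := by simp [reflFun]
      rw [reflFun_neg, h1, map_neg, neg_neg_idx]
      ring
    all_goals simp only [mem_singleton, Subtype.ext_iff, neg_val]; omega
  · intro x _ hx
    simp only [mem_insert, mem_singleton, not_or] at hx
    simp [reflFun, hx, neg_neg_idx]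

/-! ## The linear action and the roots -/

theorem basisVec_neg {n : ℕ} (x : Idx n) : basisVec (-x) = -basisVec x := by
  funext j
  have := idx_ne_zero x
  have := idx_ne_zero (pos j)
  simp only [basisVec, Pi.neg_apply, Subtype.ext_iff, neg_val]
  split_ifs <;> first | omega | simp

theorem act_add {n : ℕ} (w : SignedPerm n) (u v : Fin n → ℝ) :
    act w (u + v) = act w u + act w v := by
  simp [act, add_smul, Finset.sum_add_distrib]

theorem act_smul {n : ℕ} (w : SignedPerm n) (c : ℝ) (v : Fin n → ℝ) :
    act w (c • v) = c • act w v := by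
  simp [act, Finset.smul_sum, mul_smul]

theorem act_neg {n : ℕ} (w : SignedPerm n) (v : Fin n → ℝ) : act w (-v) = -act w v := by
  simp [act]

theorem act_sub {n : ℕ} (w : SignedPerm n) (u v : Fin n → ℝ) :
    act w (u - v) = act w u - act w v := by
  rw [sub_eq_add_neg, act_add, act_neg, ← sub_eq_add_neg]

theorem act_sum {n : ℕ} {ι : Type*} (s : Finset ι) (w : SignedPerm n) (v : ι → Fin n → ℝ) :
    act w (∑ i ∈ s, v i) = ∑ i ∈ s, act w (v i) := by
  classical
  induction s using Finset.induction_on with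
  | empty => simp [act]
  | insert a s ha ih => rw [Finset.sum_insert ha, Finset.sum_insert ha, act_add, ih]

theorem basisVec_pos {n : ℕ} (i j : Fin n) : basisVec (pos i) j = if j = i then 1 else 0 := by
  simp only [basisVec, Subtype.ext_iff, neg_val, pos_val, Fin.ext_iff]
  split_ifs <;> first | omega | rfl

theorem act_basisVec_pos {n : ℕ} (w : SignedPerm n) (i : Fin n) :
    act w (basisVec (pos i)) = basisVec (w.1 (pos i)) := by
  simp [act, basisVec_pos]

theorem act_basisVec {n : ℕ} (w : SignedPerm n) (x : Idx n) :
    act w (basisVec x) = basisVec (w.1 x) := by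
  rcases lt_or_gt_of_ne (idx_ne_zero x) with h | h
  · obtain ⟨i, hi⟩ := exists_pos (-x) (by rw [neg_val]; omega)
    rw [← neg_neg_idx x, hi, basisVec_neg, act_neg, act_basisVec_pos, map_neg, basisVec_neg]
  · obtain ⟨i, rfl⟩ := exists_pos x h
    exact act_basisVec_pos w i

theorem act_mul {n : ℕ} (u v : SignedPerm n) (β : Fin n → ℝ) :
    act (u * v) β = act u (act v β) := by
  conv_rhs => rw [act.eq_1 v, act_sum]
  simp only [act_smul, act_basisVec]
  rfl

theorem act_one {n : ℕ} (β : Fin n → ℝ) : act 1 β = β := by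
  funext j
  simp [act, basisVec_pos]

theorem simpleRoot_zero {n : ℕ} (i : Fin n) (h : (i : ℕ) = 0) :
    simpleRoot i = basisVec (pos i) := if_pos h

theorem simpleRoot_succ {n : ℕ} (i j : Fin n) (h : (j : ℕ) = i + 1) :
    simpleRoot j = basisVec (pos j) - basisVec (pos i) := by
  rw [simpleRoot, if_neg (by omega)]
  congr
  rw [h, Nat.add_sub_cancel]

theorem act_simple_simpleRoot {n : ℕ} (i : Fin n) :
    act (simple i) (simpleRoot i) = -simpleRoot i := by
  rcases exists_simple_eq i with h | ⟨j, h⟩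
  · rw [simpleRoot_zero i h, simple_zero i h, act_basisVec, ← basisVec_neg]
    simp [refl_apply, reflFun]
  · rw [simpleRoot_succ j i h, simple_succ j i h, act_sub, act_basisVec, act_basisVec, neg_sub]
    have : pos j ≠ pos i := by simp only [ne_eq, Subtype.ext_iff, pos_val]; omega
    simp [refl_apply, reflFun, this]

/-- Because indices carry signs, `e_x` covers `±e_i` and `e_x - e_y` covers all `±e_i ± e_j`. -/
theorem isReflectionOf_cases {n : ℕ} {β : Fin n → ℝ} {t : SignedPerm n}
    (h : IsReflectionOf β t) :
    (∃ x, β = basisVec x ∧ t = refl x (-x)) ∨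
      ∃ x y : Idx n, x.1 ≠ y.1 ∧ x.1 ≠ -y.1 ∧ β = basisVec x - basisVec y ∧ t = refl x y := by
  obtain ⟨w, i, rfl, rfl⟩ := h
  rcases exists_simple_eq i with h | ⟨j, h⟩
  · left
    refine ⟨w.1 (pos i), ?_, ?_⟩
    · rw [simpleRoot_zero i h, act_basisVec]
    · rw [simple_zero i h, conj_refl, map_neg]
  · right
    refine ⟨w.1 (pos i), w.1 (pos j), fun e => ?_, fun e => ?_, ?_, ?_⟩
    · have := congrArg Subtype.val (w.1.injective (Subtype.ext e))
      simp only [pos_val] at this; omega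
    · rw [← neg_val, ← map_neg] at e
      have := congrArg Subtype.val (w.1.injective (Subtype.ext e))
      simp only [pos_val, neg_val] at this; omega
    · rw [simpleRoot_succ j i h, act_sub, act_basisVec, act_basisVec]
    · rw [simple_succ j i h, conj_refl]

theorem exists_isReflectionOf {n : ℕ} {β : Fin n → ℝ} (h : β ∈ roots n) :
    ∃ t, IsReflectionOf β t := by
  obtain ⟨w, i, rfl⟩ := h
  exact ⟨_, w, i, rfl, rfl⟩

theorem IsReflectionOf.mem_roots {n : ℕ} {β : Fin n → ℝ} {t : SignedPerm n}
    (h : IsReflectionOf β t) : β ∈ roots n := by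
  obtain ⟨w, i, rfl, -⟩ := h
  exact ⟨w, i, rfl⟩

theorem IsReflectionOf.act {n : ℕ} {β : Fin n → ℝ} {t : SignedPerm n} (h : IsReflectionOf β t)
    (g : SignedPerm n) : IsReflectionOf (act g β) (g * t * g⁻¹) := by
  obtain ⟨w, i, rfl, rfl⟩ := h
  exact ⟨g * w, i, (act_mul _ _ _).symm, by group⟩

theorem isReflectionOf_simpleRoot {n : ℕ} (i : Fin n) :
    IsReflectionOf (simpleRoot i) (simple i) :=
  ⟨1, i, (act_one _).symm, by group⟩

theorem act_mem_roots {n : ℕ} {β : Fin n → ℝ} (h : β ∈ roots n) (g : SignedPerm n) :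
    act g β ∈ roots n := by
  obtain ⟨t, ht⟩ := exists_isReflectionOf h
  exact (ht.act g).mem_roots

/-! ## A linear functional bounding the depth of a root from below -/

/-- The linear functional with value `2i - 1` on `e_i`. -/
noncomputable def level {n : ℕ} (v : Fin n → ℝ) : ℝ := ∑ i : Fin n, (2 * (i : ℝ) + 1) * v i

theorem level_sub {n : ℕ} (u v : Fin n → ℝ) : level (u - v) = level u - level v := by
  simp [level, mul_sub, Finset.sum_sub_distrib]

theorem level_neg {n : ℕ} (v : Fin n → ℝ) : level (-v) = -level v := by
  simp [level]

theorem level_sum_smul {n : ℕ} (c : Fin n → ℝ) (v : Fin n → Fin n → ℝ) :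
    level (∑ i, c i • v i) = ∑ i, c i * level (v i) := by
  simp only [level, Finset.sum_apply, Pi.smul_apply, smul_eq_mul, Finset.mul_sum]
  rw [Finset.sum_comm]
  exact Finset.sum_congr rfl fun i _ => Finset.sum_congr rfl fun j _ => by ring

/-- The value of `level` on `e_x`. -/
def idxLevel {n : ℕ} (x : Idx n) : ℤ := if 0 < x.1 then 2 * x.1 - 1 else 2 * x.1 + 1

theorem idxLevel_neg {n : ℕ} (x : Idx n) : idxLevel (-x) = -idxLevel x := by
  have := idx_ne_zero x
  simp only [idxLevel, neg_val]
  split_ifs <;> omega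

theorem level_basisVec {n : ℕ} (x : Idx n) : level (basisVec x) = idxLevel x := by
  have key (i : Fin n) : level (basisVec (pos i)) = idxLevel (pos i) := by
    rw [idxLevel, if_pos (by rw [pos_val]; omega), pos_val]
    simp only [level, basisVec_pos]
    simp
    ring
  rcases lt_or_gt_of_ne (idx_ne_zero x) with h | h
  · obtain ⟨i, hi⟩ := exists_pos (-x) (by rw [neg_val]; omega)
    rw [← neg_neg_idx x, hi, basisVec_neg, level_neg, key, idxLevel_neg]
    push_cast; rfl
  · obtain ⟨i, rfl⟩ := exists_pos x h
    exact key i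

theorem level_simpleRoot_pos {n : ℕ} (i : Fin n) : 0 < level (simpleRoot i) := by
  rcases exists_simple_eq i with h | ⟨j, h⟩
  · rw [simpleRoot_zero i h, level_basisVec, idxLevel, if_pos] <;> simp only [pos_val, h]
    · norm_num
    · norm_num
  · rw [simpleRoot_succ j i h, level_sub, level_basisVec, level_basisVec, ← Int.cast_sub,
      Int.cast_pos]
    simp only [idxLevel, pos_val]
    split_ifs <;> omega

theorem level_ne_zero {n : ℕ} {β : Fin n → ℝ} (h : β ∈ roots n) : level β ≠ 0 := by
  obtain ⟨t, ht⟩ := exists_isReflectionOf h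
  have h0 (x : Idx n) := idx_ne_zero x
  rcases isReflectionOf_cases ht with ⟨x, rfl, -⟩ | ⟨x, y, h1, h2, rfl, -⟩
  · rw [level_basisVec, Int.cast_ne_zero]
    unfold idxLevel
    split_ifs <;> omega
  · rw [level_sub, level_basisVec, level_basisVec, ← Int.cast_sub, Int.cast_ne_zero]
    have := h0 x
    have := h0 y
    simp only [idxLevel]
    split_ifs <;> omega

theorem level_pos_of_mem_posRoots {n : ℕ} {β : Fin n → ℝ} (h : β ∈ posRoots n) :
    0 < level β := by
  refine lt_of_le_of_ne ?_ (level_ne_zero h.1).symm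
  obtain ⟨-, c, hc, rfl⟩ := h
  rw [level_sum_smul]
  exact Finset.sum_nonneg fun i _ => mul_nonneg (hc i) (level_simpleRoot_pos i).le

theorem level_neg_of_mem_negRoots {n : ℕ} {β : Fin n → ℝ} (h : β ∈ negRoots n) :
    level β < 0 := by
  have := level_pos_of_mem_posRoots h.2
  rw [level_neg] at this
  linarith

/-- A simple reflection lowers the level of a root by at most `2`, unless it makes it negative. -/
theorem level_le_act_simple {n : ℕ} {β : Fin n → ℝ} (h : β ∈ roots n) (i : Fin n) :
    level β ≤ level (act (simple i) β) + 2 ∨ level β ≤ 2 := by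
  obtain ⟨t, ht⟩ := exists_isReflectionOf h
  -- `s_0` only exchanges the levels `1` and `-1`; `s_i` with `i ≥ 1` only exchanges two consecutive
  -- odd levels, and their negatives. A difference of two terms can thus drop by `4`, but then its
  -- level was at most `2`.
  have e0 (h : (i : ℕ) = 0) (x : Idx n) :
      x.1 = 1 ∧ idxLevel x = 1 ∧ idxLevel ((simple i).1 x) = -1 ∨
      x.1 = -1 ∧ idxLevel x = -1 ∧ idxLevel ((simple i).1 x) = 1 ∨
      idxLevel ((simple i).1 x) = idxLevel x := by
    rw [simple_zero i h]
    simp only [idxLevel, refl_apply, reflFun, Subtype.ext_iff, neg_val, apply_ite Subtype.val,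
      pos_val, h]
    split_ifs <;> omega
  have e1 (j : Fin n) (h : (i : ℕ) = j + 1) (x : Idx n) :
      x.1 = j + 2 ∧ idxLevel x = 2 * j + 3 ∧ idxLevel ((simple i).1 x) = 2 * j + 1 ∨
      x.1 = j + 1 ∧ idxLevel x = 2 * j + 1 ∧ idxLevel ((simple i).1 x) = 2 * j + 3 ∨
      x.1 = -(j + 2) ∧ idxLevel x = -(2 * j + 3) ∧ idxLevel ((simple i).1 x) = -(2 * j + 1) ∨
      x.1 = -(j + 1) ∧ idxLevel x = -(2 * j + 1) ∧ idxLevel ((simple i).1 x) = -(2 * j + 3) ∨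
      idxLevel ((simple i).1 x) = idxLevel x := by
    have := idx_ne_zero x
    rw [simple_succ j i h]
    simp only [idxLevel, refl_apply, reflFun, Subtype.ext_iff, neg_val, apply_ite Subtype.val,
      pos_val, h]
    push_cast
    split_ifs <;> omega
  rcases isReflectionOf_cases ht with ⟨x, rfl, -⟩ | ⟨x, y, h1, h2, rfl, -⟩
  · rw [act_basisVec, level_basisVec, level_basisVec]
    norm_cast
    rcases exists_simple_eq i with h | ⟨j, h⟩
    · have := e0 h x
      omega
    · have := e1 j h x
      omega
  · rw [act_sub, act_basisVec, act_basisVec, level_sub, level_sub, level_basisVec,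
      level_basisVec, level_basisVec, level_basisVec]
    norm_cast
    rcases exists_simple_eq i with h | ⟨j, h⟩
    · have := e0 h x
      have := e0 h y
      omega
    · have := e1 j h x
      have := e1 j h y
      omega

/-- Negative roots have negative level, and each letter lowers the level by at most `2` unless it
was already at most `2`. So the depth is at least half the level. The levels `2i - 1`, `2(j - i)`
and `2(i + j) - 2` of `e_i`, `e_j - e_i` and `e_i + e_j`, halved and rounded up, are the exact
depths. -/
theorem level_le_of_act_mem_negRoots {n : ℕ} (l : List (Fin n)) {β : Fin n → ℝ}
    (hβ : β ∈ roots n) (h : act (l.map simple).prod β ∈ negRoots n) :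
    level β ≤ 2 * (l.length : ℝ) := by
  induction l using List.reverseRecOn generalizing β with
  | nil =>
    have := level_neg_of_mem_negRoots h
    simp only [List.map_nil, List.prod_nil, act_one] at this
    simp [this.le]
  | append_singleton l i ih =>
    rw [List.map_append, List.prod_append, List.map_singleton, List.prod_singleton, act_mul] at h
    have h1 := ih (act_mem_roots hβ (simple i)) h
    have h0 : (0 : ℝ) ≤ l.length := Nat.cast_nonneg _
    rw [List.length_append, List.length_singleton]
    push_cast
    rcases level_le_act_simple hβ i with h2 | h2 <;> linarith

/-! ## The depths of the positive roots -/

/-- The nonnegative combinations of the simple roots. -/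
def IsNonnegComb {n : ℕ} (β : Fin n → ℝ) : Prop :=
  ∃ c : Fin n → ℝ, (∀ i, 0 ≤ c i) ∧ β = ∑ i, c i • simpleRoot i

theorem IsNonnegComb.add {n : ℕ} {β γ : Fin n → ℝ} (hβ : IsNonnegComb β)
    (hγ : IsNonnegComb γ) : IsNonnegComb (β + γ) := by
  obtain ⟨c, hc, rfl⟩ := hβ
  obtain ⟨d, hd, rfl⟩ := hγ
  exact ⟨c + d, fun i => add_nonneg (hc i) (hd i), by
    simp [add_smul, Finset.sum_add_distrib]⟩

theorem isNonnegComb_simpleRoot {n : ℕ} (i : Fin n) : IsNonnegComb (simpleRoot i) :=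
  ⟨Pi.single i 1, fun j => by by_cases h : j = i <;> simp [h], by
    simp [Pi.single_apply]⟩

theorem isNonnegComb_basisVec {n : ℕ} (m : ℕ) (h : m < n) :
    IsNonnegComb (basisVec (pos ⟨m, h⟩)) := by
  induction m with
  | zero =>
    rw [← simpleRoot_zero ⟨0, h⟩ rfl]
    exact isNonnegComb_simpleRoot _
  | succ m ih =>
    have := (isNonnegComb_simpleRoot ⟨m + 1, h⟩).add (ih (by omega))
    rwa [simpleRoot_succ ⟨m, by omega⟩ ⟨m + 1, h⟩ rfl, sub_add_cancel] at this

theorem isNonnegComb_sub {n : ℕ} (i : Fin n) (d : ℕ) (h : i + d + 1 < n) :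
    IsNonnegComb (basisVec (pos ⟨i + d + 1, h⟩) - basisVec (pos i)) := by
  induction d with
  | zero =>
    rw [← simpleRoot_succ i ⟨i + 0 + 1, h⟩ rfl]
    exact isNonnegComb_simpleRoot _
  | succ d ih =>
    have := (isNonnegComb_simpleRoot ⟨i + (d + 1) + 1, h⟩).add (ih (by omega))
    rwa [simpleRoot_succ ⟨i + d + 1, by omega⟩ ⟨i + (d + 1) + 1, h⟩ rfl,
      sub_add_sub_cancel] at this

/-- `β` is a positive root with reflection `t`, and some product of `r` simple reflections makes
`β` negative. -/
def HasDepthLE {n : ℕ} (β : Fin n → ℝ) (t : SignedPerm n) (r : ℕ) : Prop :=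
  IsNonnegComb β ∧ IsReflectionOf β t ∧
    ∃ l : List (Fin n), l.length = r ∧ act (l.map simple).prod β ∈ negRoots n

theorem HasDepthLE.mem_posRoots {n : ℕ} {β : Fin n → ℝ} {t : SignedPerm n} {r : ℕ}
    (h : HasDepthLE β t r) : β ∈ posRoots n :=
  ⟨h.2.1.mem_roots, h.1⟩

theorem HasDepthLE.rootDepth_le {n : ℕ} {β : Fin n → ℝ} {t : SignedPerm n} {r : ℕ}
    (h : HasDepthLE β t r) : rootDepth β ≤ r :=
  Nat.sInf_le h.2.2

theorem HasDepthLE.level_le {n : ℕ} {β : Fin n → ℝ} {t : SignedPerm n} {r : ℕ}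
    (h : HasDepthLE β t r) : level β ≤ 2 * (rootDepth β : ℝ) := by
  -- The word supplied by `h` is needed here: on an empty set `sInf` would be the default value `0`.
  obtain ⟨l, hl, hl'⟩ := Nat.sInf_mem (s := {r | ∃ l : List (Fin n), l.length = r ∧
    act (l.map simple).prod β ∈ negRoots n}) ⟨r, h.2.2⟩
  have := level_le_of_act_mem_negRoots l h.2.1.mem_roots hl'
  rwa [hl] at this

theorem hasDepthLE_simpleRoot {n : ℕ} (i : Fin n) : HasDepthLE (simpleRoot i) (simple i) 1 := by
  refine ⟨isNonnegComb_simpleRoot i, isReflectionOf_simpleRoot i, [i], rfl, ?_⟩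
  rw [List.map_singleton, List.prod_singleton]
  refine ⟨act_mem_roots (isReflectionOf_simpleRoot i).mem_roots _, ?_⟩
  rw [act_simple_simpleRoot, neg_neg]
  exact ⟨(isReflectionOf_simpleRoot i).mem_roots, isNonnegComb_simpleRoot i⟩

/-- A word for `β` followed by `s_i` is a word for `s_i β`, as `s_i² = 1`. Chains of positive roots
starting at simple roots thus give the upper bounds on depths, one unit per step. -/
theorem HasDepthLE.act_simple {n : ℕ} {β : Fin n → ℝ} {t : SignedPerm n} {r : ℕ}
    (h : HasDepthLE β t r) (i : Fin n) (hc : IsNonnegComb (act (simple i) β)) :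
    HasDepthLE (act (simple i) β) (simple i * t * (simple i)⁻¹) (r + 1) := by
  obtain ⟨-, h2, l, hl, h3⟩ := h
  refine ⟨hc, h2.act _, l ++ [i], by simp [hl], ?_⟩
  rw [List.map_append, List.prod_append, List.map_singleton, List.prod_singleton, ← act_mul,
    mul_assoc, simple_mul_self, mul_one]
  exact h3

theorem simple_apply_pred {n : ℕ} (i j : Fin n) (h : (j : ℕ) = i + 1) :
    (simple j).1 (pos i) = pos j := by
  have : pos i ≠ pos j := by simp only [ne_eq, Subtype.ext_iff, pos_val]; omega
  rw [simple_succ i j h]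
  simp [refl_apply, reflFun, this]

theorem simple_apply_of_ne {n : ℕ} (j k : Fin n) (h : (k : ℕ) ≠ j) (h' : (k : ℕ) + 1 ≠ j) :
    (simple j).1 (pos k) = pos k := by
  rcases exists_simple_eq j with hj | ⟨i, hj⟩
  · rw [simple_zero j hj, refl_apply]
    simp only [reflFun, Subtype.ext_iff, neg_val, apply_ite Subtype.val, pos_val]
    split_ifs <;> omega
  · rw [simple_succ i j hj, refl_apply]
    simp only [reflFun, Subtype.ext_iff, neg_val, apply_ite Subtype.val, pos_val]
    split_ifs <;> omega

theorem hasDepthLE_basisVec {n : ℕ} (m : ℕ) (h : m < n) :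
    HasDepthLE (basisVec (pos ⟨m, h⟩)) (refl (pos ⟨m, h⟩) (-pos ⟨m, h⟩)) (m + 1) := by
  induction m with
  | zero =>
    have := hasDepthLE_simpleRoot ⟨0, h⟩
    rwa [simpleRoot_zero _ rfl, simple_zero _ rfl] at this
  | succ m ih =>
    have := (ih (by omega)).act_simple ⟨m + 1, h⟩
    rw [act_basisVec, conj_refl, map_neg,
      simple_apply_pred ⟨m, by omega⟩ ⟨m + 1, h⟩ rfl] at this
    exact this (isNonnegComb_basisVec _ _)

theorem hasDepthLE_sub {n : ℕ} (i : Fin n) (d : ℕ) (h : i + d + 1 < n) :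
    HasDepthLE (basisVec (pos ⟨i + d + 1, h⟩) - basisVec (pos i))
      (refl (pos ⟨i + d + 1, h⟩) (pos i)) (d + 1) := by
  induction d with
  | zero =>
    have := hasDepthLE_simpleRoot ⟨i + 0 + 1, h⟩
    rwa [simpleRoot_succ i _ rfl, simple_succ i _ rfl] at this
  | succ d ih =>
    have := (ih (by omega)).act_simple ⟨i + (d + 1) + 1, h⟩
    rw [act_sub, act_basisVec, act_basisVec, conj_refl,
      simple_apply_pred ⟨i + d + 1, by omega⟩ ⟨i + (d + 1) + 1, h⟩ rfl,
      simple_apply_of_ne _ i (by simp only; omega) (by simp only; omega)] at this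
    exact this (isNonnegComb_sub _ _ _)

/-- The chain goes from `e_j - e_1` to `e_j + e_1` by `s_0`, and then raises the smaller index by
`s_1, s_2, …`; these fix `e_j` as long as the index stays below `j`. -/
theorem hasDepthLE_add {n : ℕ} (m : ℕ) (j : Fin n) (h : m < j) :
    HasDepthLE (basisVec (pos j) - basisVec (-pos ⟨m, by omega⟩))
      (refl (pos j) (-pos ⟨m, by omega⟩)) (m + j + 1) := by
  have hc (m : ℕ) (h : m < j) :
      IsNonnegComb (basisVec (pos j) - basisVec (-pos (n := n) ⟨m, by omega⟩)) := by
    rw [basisVec_neg, sub_neg_eq_add]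
    exact (isNonnegComb_basisVec j j.2).add (isNonnegComb_basisVec m _)
  induction m with
  | zero =>
    have h0 : 0 < n := by omega
    obtain ⟨d, hd⟩ := Nat.exists_eq_add_of_lt h
    have := hasDepthLE_sub (n := n) ⟨0, h0⟩ d (by simp only; omega)
    rw [show (⟨((⟨0, h0⟩ : Fin n) : ℕ) + d + 1, by simp only; omega⟩ : Fin n) = j from
      Fin.ext (by simp only; omega)] at this
    have := this.act_simple ⟨0, h0⟩
    rw [act_sub, act_basisVec, act_basisVec, conj_refl,
      simple_apply_of_ne _ j (by simp only; omega) (by simp only; omega),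
      show (simple (⟨0, h0⟩ : Fin n)).1 (pos ⟨0, h0⟩) = -pos ⟨0, h0⟩ by
        rw [simple_zero _ rfl]; simp [refl_apply, reflFun]] at this
    have := this (hc 0 h)
    rwa [show 0 + (j : ℕ) + 1 = d + 1 + 1 by omega]
  | succ m ih =>
    have := (ih (by omega) hc).act_simple ⟨m + 1, by omega⟩
    rw [act_sub, act_basisVec, act_basisVec, conj_refl, map_neg,
      simple_apply_pred ⟨m, by omega⟩ ⟨m + 1, by omega⟩ rfl,
      simple_apply_of_ne _ j (by simp only; omega) (by simp only; omega)] at this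
    have := this (hc _ h)
    rwa [show m + 1 + (j : ℕ) + 1 = m + j + 1 + 1 by omega]

theorem exists_hasDepthLE_sub {n : ℕ} {p q : Idx n} (hp : 0 < p.1) (hpq : p.1 < q.1) :
    ∃ r : ℕ, (r : ℤ) = q.1 - p.1 ∧ HasDepthLE (basisVec q - basisVec p) (refl p q) r := by
  obtain ⟨i, rfl⟩ := exists_pos p hp
  obtain ⟨j, rfl⟩ := exists_pos q (by omega)
  simp only [pos_val] at hpq
  obtain ⟨d, hd⟩ := Nat.exists_eq_add_of_lt (show (i : ℕ) < j by omega)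
  obtain ⟨j, hj⟩ := j
  obtain rfl : j = i + d + 1 := hd
  rw [refl_comm]
  exact ⟨d + 1, by simp only [pos_val]; omega, hasDepthLE_sub i d _⟩

theorem exists_hasDepthLE_add {n : ℕ} {p q : Idx n} (hp : 0 < p.1) (hpq : p.1 < q.1) :
    ∃ r : ℕ, (r : ℤ) = p.1 + q.1 - 1 ∧
      HasDepthLE (basisVec q - basisVec (-p)) (refl p (-q)) r := by
  obtain ⟨i, rfl⟩ := exists_pos p hp
  obtain ⟨j, rfl⟩ := exists_pos q (by omega)
  simp only [pos_val] at hpq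
  rw [refl_comm, ← refl_neg_neg, neg_neg_idx]
  exact ⟨i + j + 1, by simp only [pos_val]; omega, hasDepthLE_add i j (by omega)⟩

theorem exists_hasDepthLE_basisVec {n : ℕ} {p : Idx n} (hp : 0 < p.1) :
    ∃ r : ℕ, (r : ℤ) = p.1 ∧ HasDepthLE (basisVec p) (refl p (-p)) r := by
  obtain ⟨i, rfl⟩ := exists_pos p hp
  exact ⟨i + 1, by simp only [pos_val]; omega, hasDepthLE_basisVec i i.2⟩

/-- The reflections of the positive roots, with lower bounds for the depths of the roots. -/
theorem posRoot_cases {n : ℕ} {β : Fin n → ℝ} {t : SignedPerm n} (hβ : β ∈ posRoots n)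
    (ht : IsReflectionOf β t) :
    ∃ p q : Idx n, 0 < p.1 ∧ (t = refl p (-p) ∧ p.1 ≤ rootDepth β ∨ p.1 < q.1 ∧
      (t = refl p q ∧ q.1 - p.1 ≤ rootDepth β ∨
        t = refl p (-q) ∧ p.1 + q.1 - 1 ≤ rootDepth β)) := by
  have hl := level_pos_of_mem_posRoots hβ
  have sub {p q : Idx n} (hp : 0 < p.1) (hpq : p.1 < q.1) :
      q.1 - p.1 ≤ rootDepth (basisVec q - basisVec p) := by
    obtain ⟨r, -, h⟩ := exists_hasDepthLE_sub hp hpq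
    have := h.level_le
    rw [level_sub, level_basisVec, level_basisVec] at this
    norm_cast at this
    simp only [idxLevel] at this
    split_ifs at this <;> omega
  have add {p q : Idx n} (hp : 0 < p.1) (hpq : p.1 < q.1) :
      p.1 + q.1 - 1 ≤ rootDepth (basisVec q - basisVec (-p)) := by
    obtain ⟨r, -, h⟩ := exists_hasDepthLE_add hp hpq
    have := h.level_le
    rw [level_sub, level_basisVec, level_basisVec] at this
    norm_cast at this
    simp only [idxLevel, neg_val] at this
    split_ifs at this <;> omega
  rcases isReflectionOf_cases ht with ⟨x, rfl, rfl⟩ | ⟨x, y, h1, h2, rfl, rfl⟩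
  · rw [level_basisVec, Int.cast_pos] at hl
    have hx : 0 < x.1 := by
      by_contra hx
      rw [idxLevel, if_neg hx] at hl
      have := idx_ne_zero x
      omega
    refine ⟨x, x, hx, Or.inl ⟨rfl, ?_⟩⟩
    obtain ⟨r, -, h⟩ := exists_hasDepthLE_basisVec hx
    have := h.level_le
    rw [level_basisVec] at this
    norm_cast at this
    rw [idxLevel, if_pos hx] at this
    omega
  · rw [level_sub, level_basisVec, level_basisVec, ← Int.cast_sub, Int.cast_pos] at hl
    have hx0 := idx_ne_zero x
    have hy0 := idx_ne_zero y
    have hlt : y.1 < x.1 := by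
      simp only [idxLevel] at hl
      split_ifs at hl <;> omega
    rcases lt_or_gt_of_ne hx0 with hx | hx
    · have hx' : 0 < (-x).1 := by rw [neg_val]; omega
      have hlt' : (-x).1 < (-y).1 := by simp only [neg_val]; omega
      refine ⟨-x, -y, hx', Or.inr ⟨hlt', Or.inl ⟨(refl_neg_neg x y).symm, ?_⟩⟩⟩
      have := sub hx' hlt'
      rwa [basisVec_neg, basisVec_neg, sub_neg_eq_add, neg_add_eq_sub] at this
    · rcases lt_or_gt_of_ne hy0 with hy | hy
      · have hy' : 0 < (-y).1 := by rw [neg_val]; omega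
        rcases lt_or_gt_of_ne (show x.1 ≠ (-y).1 from h2) with h | h
        · refine ⟨x, -y, hx, Or.inr ⟨h, Or.inr ⟨by rw [neg_neg_idx], ?_⟩⟩⟩
          have := add hx h
          rwa [basisVec_neg, basisVec_neg, sub_neg_eq_add, neg_add_eq_sub] at this
        · refine ⟨-y, x, hy', Or.inr ⟨h, Or.inr ⟨?_, ?_⟩⟩⟩
          · rw [refl_neg_neg, refl_comm]
          · have := add hy' h
            rwa [neg_neg_idx] at this
      · exact ⟨y, x, hy, Or.inr ⟨hlt, Or.inl ⟨refl_comm x y, sub hy hlt⟩⟩⟩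

/-! ## Cuts, crossings and the oddness -/

/-- The number of indices `x ≤ k` with `k < w(x)`. -/
noncomputable def crossings {n : ℕ} (w : SignedPerm n) (k : ℤ) : ℤ :=
  pairing (fun x => if x.1 ≤ k then 1 else 0) (fun y => if k < y.1 then 1 else 0) w

/-- The number of `x ∈ [k]` with `w(x) < 0`. -/
noncomputable def negCount {n : ℕ} (w : SignedPerm n) (k : ℤ) : ℤ :=
  pairing (fun x => if 0 < x.1 ∧ x.1 ≤ k then 1 else 0) (fun y => if y.1 < 0 then 1 else 0) w

/-- `w` preserves `[-k, k] \ {0}`. -/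
def Cut {n : ℕ} (w : SignedPerm n) (k : ℤ) : Prop := ∀ x : Idx n, |x.1| ≤ k → |(w.1 x).1| ≤ k

theorem Cut.lt_abs {n : ℕ} {w : SignedPerm n} {k : ℤ} (h : Cut w k) {x : Idx n}
    (hx : k < |x.1|) : k < |(w.1 x).1| := by
  by_contra hc
  have hm : Set.MapsTo w.1 {x : Idx n | |x.1| ≤ k} {x : Idx n | |x.1| ≤ k} := h
  have := Equiv.Perm.perm_symm_mapsTo_of_mapsTo w.1 hm (show w.1 x ∈ _ from not_lt.1 hc)
  rw [Equiv.symm_apply_apply] at this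
  exact absurd hx (not_lt.2 this)

theorem negCount_zero {n : ℕ} (w : SignedPerm n) : negCount w 0 = 0 := by
  unfold negCount pairing
  refine Finset.sum_eq_zero fun x _ => ?_
  dsimp only
  rw [if_neg (by omega), zero_mul]

theorem negCount_natCast {n : ℕ} (w : SignedPerm n) : negCount w n = neg w := by
  rw [negCount, pairing, sum_idx, neg, negSet, Finset.card_filter]
  push_cast
  rw [Finset.sum_eq_zero (s := univ) (f := fun i : Fin n => _ * ite ((w.1 (-pos i)).1 < 0) 1 0)]
  · rw [add_zero]
    refine Finset.sum_congr rfl fun i _ => ?_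
    rw [if_pos (by rw [pos_val]; omega), one_mul]
    rfl
  · intro i _
    rw [if_neg (by rw [neg_val, pos_val]; omega), zero_mul]

theorem cut_zero {n : ℕ} (w : SignedPerm n) : Cut w 0 := fun x hx =>
  absurd (abs_nonpos_iff.1 hx) (idx_ne_zero x)

theorem cut_natCast {n : ℕ} (w : SignedPerm n) : Cut w n := fun x _ => (mem_idx.1 (w.1 x).2).2

/-- `ε` agrees at the cuts of `w` with the parity of the number of negative entries so far. -/
def Adapted {n : ℕ} (w : SignedPerm n) (ε : ℕ → ZMod 2) : Prop :=
  ∀ k : ℕ, k ≤ n → Cut w k → ε k = negCount w k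

/-- The number of changes in the sequence `ε 0, …, ε n`. -/
def changes (n : ℕ) (ε : ℕ → ZMod 2) : ℤ := ∑ k ∈ range n, if ε k = ε (k + 1) then 0 else 1

theorem Adapted.zero {n : ℕ} {w : SignedPerm n} {ε : ℕ → ZMod 2} (h : Adapted w ε) :
    ε 0 = 0 := by
  rw [h 0 (Nat.zero_le _) (cut_zero w), Nat.cast_zero, negCount_zero, Int.cast_zero]

theorem ite_le_changes (n : ℕ) (ε : ℕ → ZMod 2) :
    (if ε 0 = ε n then 0 else 1) ≤ changes n ε := by
  induction n with
  | zero => simp [changes]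
  | succ n ih =>
    rw [changes, Finset.sum_range_succ, ← changes]
    by_cases h : ε n = ε (n + 1)
    · rw [if_pos h, ← h, add_zero]; exact ih
    · rw [if_neg h]
      have : 0 ≤ changes n ε := Finset.sum_nonneg fun k _ => by split_ifs <;> norm_num
      split_ifs <;> omega

theorem changes_add (m l : ℕ) (ε : ℕ → ZMod 2) :
    changes (m + l) ε = changes m ε + changes l fun k => ε (m + k) := by
  rw [changes, Finset.sum_range_add]
  rfl

theorem changes_add_const (n : ℕ) (ε : ℕ → ZMod 2) (c : ZMod 2) :
    changes n (fun k => c + ε k) = changes n ε := by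
  simp [changes]

theorem changes_of_const {n : ℕ} (hn : 1 ≤ n) {ε : ℕ → ZMod 2} {c : ZMod 2} (h0 : ε 0 = 0)
    (h : ∀ k, 0 < k → k ≤ n → ε k = c) : changes n ε = if 0 = c then 0 else 1 := by
  obtain ⟨m, rfl⟩ := Nat.exists_eq_add_of_le' hn
  rw [changes, Finset.sum_range_succ', Finset.sum_eq_zero, zero_add, h0,
    h (0 + 1) (by omega) (by omega)]
  intro k hk
  have := Finset.mem_range.1 hk
  rw [h (k + 1) (by omega) (by omega), h (k + 1 + 1) (by omega) (by omega), if_pos rfl]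

/-! ### Cuts and negative entries of direct sums, and the oddness as a minimal number of changes. -/

theorem high_val_abs {k l : ℕ} (y : Idx l) : |(high k l y).1| = |y.1| + k := by
  rcases lt_or_gt_of_ne (idx_ne_zero y) with h | h
  · rw [show (high k l y).1 = y.1 - k from shift_of_neg k h, abs_of_neg h, abs_of_neg (by omega)]
    ring
  · rw [show (high k l y).1 = y.1 + k from shift_of_pos k h, abs_of_pos h, abs_of_pos (by omega)]

theorem high_val_cases {k l : ℕ} (y : Idx l) :
    (0 < y.1 ∧ (high k l y).1 = y.1 + k) ∨ (y.1 < 0 ∧ (high k l y).1 = y.1 - k) := by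
  rcases lt_or_gt_of_ne (idx_ne_zero y) with h | h
  · exact Or.inr ⟨h, shift_of_neg k h⟩
  · exact Or.inl ⟨h, shift_of_pos k h⟩

theorem low_val {k l : ℕ} (x : Idx k) : (low k l x).1 = x.1 := rfl

theorem cut_of_cut_directSum {k l : ℕ} {u : SignedPerm k} {v : SignedPerm l} {j : ℤ}
    (h : Cut (directSum u v) j) : Cut u j := fun x hx => by
  have := h (low k l x) hx
  rwa [directSum_low] at this

theorem cut_directSum_add {k l : ℕ} (u : SignedPerm k) (v : SignedPerm l) (j : ℕ) :
    Cut (directSum u v) ((k + j : ℕ) : ℤ) ↔ Cut v j := by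
  constructor
  · intro h y hy
    have := h (high k l y) (by rw [high_val_abs]; push_cast; omega)
    rw [directSum_high, high_val_abs] at this
    push_cast at this
    omega
  · intro h x hx
    rcases low_or_high x with ⟨x, rfl⟩ | ⟨y, rfl⟩
    · rw [directSum_low, low_val]
      have := (mem_idx.1 (u.1 x).2).2
      push_cast
      omega
    · rw [directSum_high, high_val_abs]
      rw [high_val_abs] at hx
      push_cast at hx ⊢
      have := h y (by omega)
      omega

theorem pairing_directSum {k l : ℕ} (A B : Idx (k + l) → ℤ) (u : SignedPerm k)
    (v : SignedPerm l) : pairing A B (directSum u v) =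
      pairing (fun x => A (low k l x)) (fun x => B (low k l x)) u +
        pairing (fun y => A (high k l y)) (fun y => B (high k l y)) v := by
  rw [pairing, ← Equiv.sum_comp (split k l), Fintype.sum_sum_type]
  congr 1 <;> refine Finset.sum_congr rfl fun x _ => ?_
  · rw [show split k l (Sum.inl x) = low k l x from rfl, directSum_low]
  · rw [show split k l (Sum.inr x) = high k l x from rfl, directSum_high]

theorem negCount_directSum {k l : ℕ} (u : SignedPerm k) (v : SignedPerm l) (j : ℕ) :
    negCount (directSum u v) ((k + j : ℕ) : ℤ) = neg u + negCount v j := by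
  rw [negCount, pairing_directSum, ← negCount_natCast]
  congr 1 <;> refine Finset.sum_congr rfl fun x _ => ?_
  · simp only [low_val]
    have := idx_le x
    congr 2
    rw [eq_iff_iff]
    push_cast
    omega
  · have h1 := high_val_cases (k := k) x
    have h2 := high_val_cases (k := k) (v.1 x)
    congr 1 <;> dsimp only <;> congr 1 <;> rw [eq_iff_iff]
    · push_cast
      omega
    · omega

theorem decomposable_of_cut {m k : ℕ} {u : SignedPerm m} (hk : 0 < k) (hkm : k < m)
    (h : Cut u k) : Decomposable ⟨m, u⟩ := by
  obtain ⟨d, rfl⟩ := Nat.exists_eq_add_of_le hkm.le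
  obtain ⟨a, b, hab⟩ := exists_directSum u fun x => by
    have := h (low k d x) (mem_idx.1 x.2).2
    obtain ⟨y, hy⟩ := exists_idx (idx_ne_zero _) this
    exact ⟨y, Subtype.ext hy.symm⟩
  exact ⟨k, d, a, b, hk, by omega, by rw [← hab]⟩

/-- The number of blocks with an odd number of negative entries. -/
noncomputable def oddBlocks (L : List AnySignedPerm) : ℕ :=
  L.countP fun b => decide (Odd (neg b.2))

theorem oddBlocks_cons (b : AnySignedPerm) (L : List AnySignedPerm) :
    (oddBlocks (b :: L) : ℤ) =
      (if (0 : ZMod 2) = ((neg b.2 : ℕ) : ZMod 2) then 0 else 1) + oddBlocks L := by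
  have h : (0 : ZMod 2) = ((neg b.2 : ℕ) : ZMod 2) ↔ ¬Odd (neg b.2) := by
    rw [eq_comm, ZMod.natCast_eq_zero_iff_even, Nat.not_odd_iff_even]
  rw [oddBlocks, List.countP_cons, ← oddBlocks]
  by_cases ho : Odd (neg b.2)
  · rw [if_neg (fun e => h.1 e ho)]
    simp [ho, add_comm]
  · rw [if_pos (h.2 ho)]
    simp [ho]

/-- Both ends of a block are cuts, and the values of `ε` there differ by the parity of the negative
entries in the block. So each odd block contains at least one change. -/
theorem oddBlocks_le_changes (L : List AnySignedPerm) (ε : ℕ → ZMod 2)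
    (h : Adapted (listSum L).2 ε) : oddBlocks L ≤ changes (listSum L).1 ε := by
  induction L generalizing ε with
  | nil => simp [oddBlocks, changes, listSum]
  | cons b L ih =>
    have hε0 := h.zero
    have key (k : ℕ) (hk : k ≤ (listSum L).1) (hc : Cut (listSum L).2 k) :
        ε (b.1 + k) = ((neg b.2 : ℕ) : ZMod 2) + negCount (listSum L).2 k := by
      have := h (b.1 + k) (Nat.add_le_add_left hk _) ((cut_directSum_add b.2 _ k).2 hc)
      rw [this]
      refine (congrArg _ (negCount_directSum b.2 (listSum L).2 k)).trans ?_
      push_cast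
      rfl
    have hb : ε b.1 = ((neg b.2 : ℕ) : ZMod 2) := by
      have := key 0 (Nat.zero_le _) (cut_zero _)
      rwa [Nat.cast_zero, negCount_zero, Int.cast_zero, add_zero, add_zero] at this
    have h1 := ite_le_changes b.1 ε
    rw [hε0, hb] at h1
    -- The tail of `ε` is translated by its first value, so that it starts at `0` and is adapted to
    -- the remaining blocks; a translation preserves the changes.
    have h2 := ih (fun k => ε b.1 + ε (b.1 + k)) fun k hk hc => by
      simp only
      rw [key k hk hc, hb, ← add_assoc, CharTwo.add_self_eq_zero, zero_add]
    rw [changes_add_const (listSum L).1 (fun k => ε (b.1 + k))] at h2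
    rw [oddBlocks_cons, show (listSum (b :: L)).1 = b.1 + (listSum L).1 from rfl, changes_add]
    exact add_le_add h1 h2

/-- The optimal sequence changes only in the first step of an odd block. The last clause records
this constancy away from cuts; the descent arguments depend on it. -/
theorem exists_changes_eq_oddBlocks (L : List AnySignedPerm)
    (hL : ∀ b ∈ L, 1 ≤ b.1 ∧ ¬Decomposable b) :
    ∃ ε, Adapted (listSum L).2 ε ∧ changes (listSum L).1 ε = oddBlocks L ∧
      ∀ k : ℕ, 0 < k → k < (listSum L).1 → ¬Cut (listSum L).2 k → ε k = ε (k + 1) := by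
  induction L with
  | nil =>
    refine ⟨0, fun k hk _ => ?_, by simp [oddBlocks, changes, listSum], fun k _ hk => ?_⟩
    · obtain rfl : k = 0 := Nat.le_zero.1 hk
      rw [Nat.cast_zero, negCount_zero]
      rfl
    · exact absurd hk (Nat.not_lt_zero k)
  | cons b L ih =>
    obtain ⟨δ, h1, h2, h3⟩ := ih fun c hc => hL c (List.mem_cons_of_mem b hc)
    obtain ⟨hb, hd⟩ := hL b List.mem_cons_self
    have hδ := h1.zero
    -- For `k ≤ b.1` the truncated difference `k - b.1` is `0` and `δ 0 = 0`, so `ε` is constant on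
    -- the first block except at `k = 0`.
    let ε : ℕ → ZMod 2 := fun k => if k = 0 then 0 else ((neg b.2 : ℕ) : ZMod 2) + δ (k - b.1)
    have hε (k : ℕ) : ε (b.1 + k) = ((neg b.2 : ℕ) : ZMod 2) + δ k := by
      simp only [ε]
      rw [if_neg (by omega), Nat.add_sub_cancel_left]
    have hε' (k : ℕ) (h0 : 0 < k) (hk : k ≤ b.1) : ε k = ((neg b.2 : ℕ) : ZMod 2) := by
      simp only [ε]
      rw [if_neg (by omega), Nat.sub_eq_zero_of_le hk, hδ, add_zero]
    refine ⟨ε, fun k hk hc => ?_, ?_, fun k h0 hk hc => ?_⟩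
    · rcases Nat.lt_or_ge k b.1 with hlt | hge
      · rcases Nat.eq_zero_or_pos k with rfl | hpos
        · rw [Nat.cast_zero, negCount_zero]
          rfl
        · exact absurd (decomposable_of_cut hpos hlt (cut_of_cut_directSum hc)) hd
      · obtain ⟨j, rfl⟩ := Nat.exists_eq_add_of_le hge
        have hc' : Cut (listSum L).2 j := (cut_directSum_add b.2 _ j).1 hc
        rw [hε, h1 j (Nat.le_of_add_le_add_left hk) hc']
        refine Eq.trans ?_ (congrArg _ (negCount_directSum b.2 (listSum L).2 j)).symm
        push_cast
        rfl
    · rw [oddBlocks_cons, show (listSum (b :: L)).1 = b.1 + (listSum L).1 from rfl, changes_add,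
        ← h2]
      congr 1
      · exact changes_of_const hb rfl hε'
      · simp only [hε]
        exact changes_add_const _ _ _
    · rcases Nat.lt_or_ge k b.1 with hlt | hge
      · rw [hε' k h0 hlt.le, hε' (k + 1) (by omega) hlt]
      · obtain ⟨j, rfl⟩ := Nat.exists_eq_add_of_le hge
        have hc' : ¬Cut (listSum L).2 j := fun hc' => hc ((cut_directSum_add b.2 _ j).2 hc')
        have hj : 0 < j := by
          rcases Nat.eq_zero_or_pos j with rfl | hj
          · exact absurd (cut_zero _) hc'
          · exact hj
        rw [hε, add_assoc, hε, h3 j hj (Nat.lt_of_add_lt_add_left hk) hc']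

theorem oddness_le_changes {n : ℕ} {w : SignedPerm n} {ε : ℕ → ZMod 2} (h : Adapted w ε) :
    oddness w ≤ changes n ε := by
  have hw := ((isDecomposition_iff w (blocks w)).2 rfl).2
  have := oddBlocks_le_changes (blocks w) ε (by rw [hw]; exact h)
  rw [hw] at this
  exact this

theorem exists_changes_eq_oddness {n : ℕ} (w : SignedPerm n) :
    ∃ ε, Adapted w ε ∧ changes n ε = oddness w ∧
      ∀ k : ℕ, 0 < k → k < n → ¬Cut w k → ε k = ε (k + 1) := by
  obtain ⟨hL, hw⟩ := (isDecomposition_iff w (blocks w)).2 rfl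
  have := exists_changes_eq_oddBlocks (blocks w) hL
  rw [hw] at this
  exact this

/-! ## The effect of a reflection on cuts, crossings and negative entries -/

theorem mul_refl_left {n : ℕ} (w : SignedPerm n) (p q : Idx n) :
    (w * refl p q).1 p = w.1 q := by
  rw [mul_val, refl_apply]
  simp [reflFun]

theorem mul_refl_right {n : ℕ} (w : SignedPerm n) (p q : Idx n) :
    (w * refl p q).1 q = w.1 p := by
  rw [refl_comm, mul_refl_left]

theorem mul_refl_of_ne {n : ℕ} (w : SignedPerm n) {p q x : Idx n} (hp : |x.1| ≠ |p.1|)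
    (hq : |x.1| ≠ |q.1|) : (w * refl p q).1 x = w.1 x := by
  have hx (y : Idx n) (h : |x.1| ≠ |y.1|) : x ≠ y ∧ x ≠ -y :=
    ⟨fun e => h (by rw [e]), fun e => h (by rw [e, neg_val, abs_neg])⟩
  have h1 := hx p hp
  have h2 := hx q hq
  rw [mul_val, refl_apply]
  simp [reflFun, h1, h2]

/-- If `|p|` and `|q|` lie on the same side of `k`, the reflection itself preserves `[-k, k]`. -/
theorem cut_mul_refl {n : ℕ} {w : SignedPerm n} {p q : Idx n} {k : ℤ}
    (hpq : |p.1| ≤ k ↔ |q.1| ≤ k) : Cut (w * refl p q) k ↔ Cut w k := by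
  have ht (x : Idx n) (hx : |x.1| ≤ k) : |(reflFun p q x).1| ≤ k := by
    unfold reflFun
    split_ifs with h1 h2 h3 h4
    · exact hpq.1 (h1 ▸ hx)
    · exact hpq.2 (h2 ▸ hx)
    · rw [h3, neg_val, abs_neg] at hx
      rw [neg_val, abs_neg]
      exact hpq.1 hx
    · rw [h4, neg_val, abs_neg] at hx
      rw [neg_val, abs_neg]
      exact hpq.2 hx
    · exact hx
  constructor
  · intro h x hx
    have := h _ (ht x hx)
    rwa [mul_val, refl_apply, reflFun_reflFun] at this
  · intro h x hx
    exact h _ (ht x hx)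

theorem crossings_mul_refl {n : ℕ} (w : SignedPerm n) {p q : Idx n} (hp : 0 < p.1)
    (hpq : p.1 < q.1) {k : ℤ} (hk : 0 ≤ k) :
    crossings (w * refl p q) k = crossings w k +
      if p.1 ≤ k ∧ k < q.1 then
        (if k < (w.1 q).1 then 1 else 0) - (if k < (w.1 p).1 then 1 else 0) else 0 := by
  rw [crossings, pairing_mul_refl_of_ne _ _ _ (by omega) (by omega), ← crossings]
  simp only [neg_val]
  split_ifs <;> omega

theorem crossings_mul_refl_neg {n : ℕ} (w : SignedPerm n) {p q : Idx n} (hp : 0 < p.1)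
    (hpq : p.1 < q.1) {k : ℤ} (hk : 0 ≤ k) :
    crossings (w * refl p (-q)) k = crossings w k +
      (if k < p.1 then
        (if k < (w.1 p).1 then 1 else 0) - (if k < -(w.1 q).1 then 1 else 0) else 0) +
      if k < q.1 then
        (if k < (w.1 q).1 then 1 else 0) - (if k < -(w.1 p).1 then 1 else 0) else 0 := by
  rw [crossings, pairing_mul_refl_of_ne _ _ _ (by rw [neg_val]; omega) (by rw [neg_val]; omega),
    ← crossings]
  simp only [neg_val, map_neg, neg_neg, if_pos (show -p.1 ≤ k by omega),
    if_pos (show -q.1 ≤ k by omega)]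
  -- The indicators of the entries enter linearly; as unknowns they leave only the positions of `p`
  -- and `q` to be split.
  generalize (if k < (w.1 p).1 then (1 : ℤ) else 0) = a
  generalize (if k < (w.1 q).1 then (1 : ℤ) else 0) = b
  generalize (if k < -(w.1 p).1 then (1 : ℤ) else 0) = c
  generalize (if k < -(w.1 q).1 then (1 : ℤ) else 0) = d
  split_ifs <;> omega

theorem crossings_mul_signChange {n : ℕ} (w : SignedPerm n) {p : Idx n} (hp : 0 < p.1)
    {k : ℤ} (hk : 0 ≤ k) :
    crossings (w * refl p (-p)) k = crossings w k +
      if k < p.1 then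
        (if k < (w.1 p).1 then 1 else 0) - (if k < -(w.1 p).1 then 1 else 0) else 0 := by
  rw [crossings, pairing_mul_refl_neg, ← crossings]
  simp only [neg_val]
  split_ifs <;> omega

theorem negCount_mul_refl {n : ℕ} (w : SignedPerm n) {p q : Idx n} (hp : 0 < p.1)
    (hpq : p.1 < q.1) (k : ℤ) :
    negCount (w * refl p q) k = negCount w k +
      if p.1 ≤ k ∧ k < q.1 then
        (if (w.1 q).1 < 0 then 1 else 0) - (if (w.1 p).1 < 0 then 1 else 0) else 0 := by
  rw [negCount, pairing_mul_refl_of_ne _ _ _ (by omega) (by omega), ← negCount]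
  simp only [neg_val]
  split_ifs <;> omega

theorem negCount_mul_refl_neg {n : ℕ} (w : SignedPerm n) {p q : Idx n} (hp : 0 < p.1)
    (hpq : p.1 < q.1) (k : ℤ) :
    negCount (w * refl p (-q)) k = negCount w k +
      (if p.1 ≤ k then
        (if 0 < (w.1 q).1 then 1 else 0) - (if (w.1 p).1 < 0 then 1 else 0) else 0) +
      if q.1 ≤ k then
        (if 0 < (w.1 p).1 then 1 else 0) - (if (w.1 q).1 < 0 then 1 else 0) else 0 := by
  rw [negCount, pairing_mul_refl_of_ne _ _ _ (by rw [neg_val]; omega) (by rw [neg_val]; omega),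
    ← negCount]
  have h1 : ¬(0 < -p.1 ∧ -p.1 ≤ k) := by omega
  have h2 : ¬(0 < -q.1 ∧ -q.1 ≤ k) := by omega
  simp only [neg_val, map_neg, neg_neg, if_neg h1, if_neg h2, hp, hp.trans hpq, true_and,
    neg_lt_zero]
  generalize (if (w.1 p).1 < 0 then (1 : ℤ) else 0) = a
  generalize (if (w.1 q).1 < 0 then (1 : ℤ) else 0) = b
  generalize (if 0 < (w.1 p).1 then (1 : ℤ) else 0) = c
  generalize (if 0 < (w.1 q).1 then (1 : ℤ) else 0) = d
  split_ifs <;> omega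

theorem negCount_mul_signChange {n : ℕ} (w : SignedPerm n) {p : Idx n} (hp : 0 < p.1) (k : ℤ) :
    negCount (w * refl p (-p)) k = negCount w k +
      if p.1 ≤ k then
        (if 0 < (w.1 p).1 then 1 else 0) - (if (w.1 p).1 < 0 then 1 else 0) else 0 := by
  rw [negCount, pairing_mul_refl_neg, ← negCount]
  simp only [neg_val]
  split_ifs <;> omega

/-! ## The weight -/

/-- The sum of the crossing numbers at the inner positions. -/
noncomputable def innerCrossings {n : ℕ} (w : SignedPerm n) : ℤ :=
  ∑ k ∈ Ico 1 n, crossings w (k : ℕ)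

/-- Twice the claimed value of the depth. -/
noncomputable def weight {n : ℕ} (w : SignedPerm n) : ℤ :=
  crossings w 0 + 2 * innerCrossings w + oddness w

/-- Each position where `δ` and `ε` differ touches two consecutive steps, hence creates at most two
changes. -/
theorem changes_le_add {n : ℕ} {ε δ : ℕ → ZMod 2} (h0 : δ 0 = ε 0) (hn : δ n = ε n) :
    changes n δ ≤ changes n ε + 2 * ∑ k ∈ Ico 1 n, if δ k = ε k then 0 else 1 := by
  rcases Nat.eq_zero_or_pos n with rfl | hpos
  · simp [changes]
  set d : ℕ → ℤ := fun k => if δ k = ε k then 0 else 1 with hd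
  have hd0 : d 0 = 0 := if_pos h0
  have hdn : d n = 0 := if_pos hn
  have h1 : ∑ k ∈ range n, d k = ∑ k ∈ Ico 1 n, d k := by
    rw [Finset.range_eq_Ico, Finset.sum_eq_sum_Ico_succ_bot hpos, hd0, zero_add]
  have h2 : ∑ k ∈ range n, d (k + 1) = ∑ k ∈ Ico 1 n, d k := by
    have := Finset.sum_range_succ' d n
    rw [Finset.sum_range_succ, h1, hd0, hdn, add_zero, add_zero] at this
    exact this.symm
  have h3 : changes n δ ≤ ∑ k ∈ range n, ((if ε k = ε (k + 1) then 0 else 1) +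
      d k + d (k + 1)) := by
    refine Finset.sum_le_sum fun k _ => ?_
    simp only [hd]
    split_ifs <;> simp_all
  rw [Finset.sum_add_distrib, Finset.sum_add_distrib, h1, h2, ← changes] at h3
  linarith

/-- Here `c k` is the budget for new crossings at `k`. Where the budget is not exhausted, the spare
crossing is worth `2` in the weight and pays for resetting `ε` at `k` to the parity required by `u`.
Where it is exhausted, a cut of `u` is already a cut of `w` with the same parity, so `ε` can be
kept. -/
theorem innerCrossings_add_oddness_le {n : ℕ} {w u : SignedPerm n} (c : ℕ → ℤ)
    (h1 : ∀ k : ℕ, 1 ≤ k → k < n → crossings u k ≤ crossings w k + c k)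
    (h2 : ∀ k : ℕ, 1 ≤ k → k < n → Cut u k → crossings u k + 1 ≤ crossings w k + c k ∨
      (Cut w k ∧ (negCount u k : ZMod 2) = negCount w k))
    (h3 : (negCount u n : ZMod 2) = negCount w n) :
    2 * innerCrossings u + oddness u ≤
      2 * innerCrossings w + oddness w + 2 * ∑ k ∈ Ico 1 n, c k := by
  classical
  obtain ⟨ε, hε, ho, -⟩ := exists_changes_eq_oddness w
  let δ : ℕ → ZMod 2 := fun k =>
    if 1 ≤ k ∧ k < n ∧ crossings u k + 1 ≤ crossings w k + c k then negCount u k else ε k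
  have hδ0 : δ 0 = ε 0 := if_neg (by omega)
  have hδn : δ n = ε n := if_neg (by omega)
  have hδ : Adapted u δ := by
    intro k hk hc
    rcases Nat.eq_zero_or_pos k with rfl | hpos
    · rw [hδ0, hε.zero, Nat.cast_zero, negCount_zero, Int.cast_zero]
    rcases Nat.lt_or_ge k n with hlt | hge
    · by_cases hs : crossings u k + 1 ≤ crossings w k + c k
      · exact if_pos ⟨hpos, hlt, hs⟩
      · obtain ⟨hw, hN⟩ := (h2 k hpos hlt hc).resolve_left hs
        rw [hN, ← hε k hk hw]
        exact if_neg fun h => hs h.2.2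
    · obtain rfl : k = n := le_antisymm hk hge
      rw [hδn, h3, hε k hk (cut_natCast w)]
  have hle := (oddness_le_changes hδ).trans (changes_le_add hδ0 hδn)
  rw [ho] at hle
  have hsum : innerCrossings u + ∑ k ∈ Ico 1 n, (if δ k = ε k then 0 else 1 : ℤ) ≤
      innerCrossings w + ∑ k ∈ Ico 1 n, c k := by
    rw [innerCrossings, innerCrossings, ← Finset.sum_add_distrib, ← Finset.sum_add_distrib]
    refine Finset.sum_le_sum fun k hk => ?_
    obtain ⟨hk1, hkn⟩ := Finset.mem_Ico.1 hk
    by_cases hs : crossings u k + 1 ≤ crossings w k + c k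
    · split_ifs <;> omega
    · rw [if_pos (show δ k = ε k from if_neg fun h => hs h.2.2), add_zero]
      exact h1 k hk1 hkn
  omega

theorem sum_ite_lt {n : ℕ} (p : Idx n) (hp : 0 < p.1) :
    ∑ k ∈ Ico 1 n, (if (k : ℤ) < p.1 then 1 else 0 : ℤ) = p.1 - 1 := by
  obtain ⟨i, rfl⟩ := exists_pos p hp
  rw [← Finset.sum_filter, Finset.sum_const, show
    ((Ico 1 n).filter fun k : ℕ => (k : ℤ) < (pos i).1) = Ico 1 ((i : ℕ) + 1) by
      ext k
      rw [Finset.mem_filter, Finset.mem_Ico, Finset.mem_Ico, pos_val]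
      have := i.2
      omega]
  simp [pos_val]

theorem sum_ite_le_and_lt {n : ℕ} {p q : Idx n} (hp : 0 < p.1) (hpq : p.1 < q.1) :
    ∑ k ∈ Ico 1 n, (if p.1 ≤ (k : ℤ) ∧ (k : ℤ) < q.1 then 1 else 0 : ℤ) = q.1 - p.1 := by
  have h1 := sum_ite_lt p hp
  have h2 := sum_ite_lt q (hp.trans hpq)
  rw [show q.1 - p.1 = (q.1 - 1) - (p.1 - 1) by ring, ← h1, ← h2, ← Finset.sum_sub_distrib]
  exact Finset.sum_congr rfl fun k _ => by split_ifs <;> omega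

theorem weight_mul_refl_le {n : ℕ} (w : SignedPerm n) {p q : Idx n} (hp : 0 < p.1)
    (hpq : p.1 < q.1) : weight (w * refl p q) ≤ weight w + 2 * (q.1 - p.1) := by
  have h0 := crossings_mul_refl w hp hpq (le_refl 0)
  rw [if_neg (by omega)] at h0
  have := innerCrossings_add_oddness_le (w := w) (u := w * refl p q)
    (fun k => if p.1 ≤ (k : ℤ) ∧ (k : ℤ) < q.1 then 1 else 0) ?_ ?_ ?_
  · rw [sum_ite_le_and_lt hp hpq] at this
    unfold weight
    omega
  · intro k _ _
    rw [crossings_mul_refl w hp hpq (by omega)]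
    split_ifs <;> omega
  · intro k _ _ hc
    rw [crossings_mul_refl w hp hpq (by omega), negCount_mul_refl w hp hpq]
    by_cases hk : p.1 ≤ (k : ℤ) ∧ (k : ℤ) < q.1
    · left
      -- A cut at such a `k` forces `|w(q)| ≤ k`, so no crossing is gained at `k` and the budget of
      -- `1` is left over.
      have h1 := hc p (abs_le.2 ⟨by omega, hk.1⟩)
      rw [mul_refl_left] at h1
      have := (abs_le.1 h1).2
      rw [if_pos hk, if_pos hk, if_neg (not_lt.2 this)]
      split_ifs <;> omega
    · right
      rw [if_neg hk, add_zero]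
      refine ⟨(cut_mul_refl ?_).1 hc, rfl⟩
      rw [abs_of_pos hp, abs_of_pos (hp.trans hpq)]
      omega
  · have := idx_le q
    rw [negCount_mul_refl w hp hpq, if_neg (by omega), add_zero]

/-- Either neither position counts, or both entries change sign and the count moves by `0` or `±2`.
-/
theorem negCount_mul_refl_neg_cast {n : ℕ} (w : SignedPerm n) {p q : Idx n} (hp : 0 < p.1)
    (hpq : p.1 < q.1) {k : ℤ} (hk : k < p.1 ∨ q.1 ≤ k) :
    (negCount (w * refl p (-q)) k : ZMod 2) = negCount w k := by
  have hwp := idx_ne_zero (w.1 p)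
  have hwq := idx_ne_zero (w.1 q)
  rw [negCount_mul_refl_neg w hp hpq]
  rcases hk with hk | hk
  · rw [if_neg (by omega), if_neg (by omega), add_zero, add_zero]
  rw [if_pos (by omega), if_pos hk]
  have (a : ℤ) : ((a + (2 : ℤ) : ℤ) : ZMod 2) = a ∧ ((a + (-2 : ℤ) : ℤ) : ZMod 2) = a := by
    push_cast
    rw [show (2 : ZMod 2) = 0 from rfl]
    simp
  rcases lt_or_gt_of_ne hwp with h1 | h1 <;> rcases lt_or_gt_of_ne hwq with h2 | h2 <;>
    simp [h1, h2, h1.le, h2.le, not_lt.2, add_assoc, this]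

/-- The inner budget sums to `(p - 1) + (q - 1)`, which counts twice, and `c_0` grows by at most
`2`. This adds up to `2 (p + q - 1)`. -/
theorem weight_mul_refl_neg_le {n : ℕ} (w : SignedPerm n) {p q : Idx n} (hp : 0 < p.1)
    (hpq : p.1 < q.1) : weight (w * refl p (-q)) ≤ weight w + 2 * (p.1 + q.1 - 1) := by
  have hq := hp.trans hpq
  have h0 := crossings_mul_refl_neg w hp hpq (le_refl 0)
  have := innerCrossings_add_oddness_le (w := w) (u := w * refl p (-q))
    (fun k => (if (k : ℤ) < p.1 then 1 else 0) + if (k : ℤ) < q.1 then 1 else 0) ?_ ?_ ?_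
  · rw [Finset.sum_add_distrib, sum_ite_lt p hp, sum_ite_lt q hq] at this
    unfold weight
    split_ifs at h0 <;> omega
  · intro k _ _
    rw [crossings_mul_refl_neg w hp hpq (by omega)]
    split_ifs <;> omega
  · intro k _ _ hc
    rw [crossings_mul_refl_neg w hp hpq (by omega)]
    by_cases hk : p.1 ≤ (k : ℤ) ∧ (k : ℤ) < q.1
    · left
      have h1 := hc p (abs_le.2 ⟨by omega, hk.1⟩)
      rw [mul_refl_left, map_neg, neg_val, abs_neg] at h1
      have := (abs_le.1 h1).2
      simp only [if_neg (not_lt.2 hk.1), if_pos hk.2, if_neg (not_lt.2 this)]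
      split_ifs <;> omega
    · right
      refine ⟨(cut_mul_refl ?_).1 hc, ?_⟩
      · rw [neg_val, abs_neg, abs_of_pos hp, abs_of_pos hq]
        omega
      · exact negCount_mul_refl_neg_cast w hp hpq (by omega)
  · exact negCount_mul_refl_neg_cast w hp hpq (Or.inr (idx_le q))

/-- Flipping a tail of the sequence affects only the step from `m` to `m + 1`. -/
theorem changes_le_add_one {n : ℕ} (m : ℕ) (ε : ℕ → ZMod 2) :
    changes n (fun k => ε k + if m < k then 1 else 0) ≤ changes n ε + 1 := by
  have h : changes n (fun k => ε k + if m < k then 1 else 0) ≤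
      ∑ k ∈ range n, ((if ε k = ε (k + 1) then 0 else 1) + if k = m then 1 else 0) := by
    refine Finset.sum_le_sum fun k _ => ?_
    rcases lt_trichotomy k m with hk | rfl | hk
    · simp only [if_neg (not_lt.2 hk.le), if_neg (show ¬m < k + 1 by omega), if_neg hk.ne,
        add_zero, le_refl]
    · simp only [if_true]
      split_ifs <;> norm_num
    · simp only [if_pos hk, if_pos (hk.trans (Nat.lt_succ_self k)), add_left_inj, if_neg hk.ne',
        add_zero, le_refl]
  rw [Finset.sum_add_distrib, ← changes, Finset.sum_ite_eq'] at h
  split_ifs at h <;> omega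

theorem cut_mul_signChange {n : ℕ} {w : SignedPerm n} {p : Idx n} {k : ℤ} :
    Cut (w * refl p (-p)) k ↔ Cut w k :=
  cut_mul_refl (by rw [neg_val, abs_neg])

theorem negCount_mul_signChange_cast {n : ℕ} (w : SignedPerm n) {p : Idx n} (hp : 0 < p.1)
    (k : ℤ) : (negCount (w * refl p (-p)) k : ZMod 2) =
      negCount w k + if p.1 ≤ k then 1 else 0 := by
  rw [negCount_mul_signChange w hp]
  push_cast
  congr 1
  have := idx_ne_zero (w.1 p)
  split_ifs <;> first | omega | simp

/-- The sign change preserves all cuts and flips the parity from position `p` on. The increases are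
at most `1` for `c_0`, `2 (p - 1)` for the inner crossings and `1` for the oddness, in total `2p`.
-/
theorem weight_mul_signChange_le {n : ℕ} (w : SignedPerm n) {p : Idx n} (hp : 0 < p.1) :
    weight (w * refl p (-p)) ≤ weight w + 2 * p.1 := by
  have h0 := crossings_mul_signChange w hp (le_refl 0)
  have h1 : innerCrossings (w * refl p (-p)) ≤ innerCrossings w + (p.1 - 1) := by
    rw [← sum_ite_lt p hp, innerCrossings, innerCrossings, ← Finset.sum_add_distrib]
    refine Finset.sum_le_sum fun k _ => ?_
    rw [crossings_mul_signChange w hp (by omega)]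
    split_ifs <;> omega
  obtain ⟨ε, hε, ho, -⟩ := exists_changes_eq_oddness w
  -- The flip is placed after `p - 1`, because `p - 1 < k` means `p ≤ k`.
  have h2 : Adapted (w * refl p (-p))
      (fun k => ε k + if (p.1 - 1).toNat < k then 1 else 0) := by
    intro k hk hc
    simp only
    rw [negCount_mul_signChange_cast w hp, hε k hk (cut_mul_signChange.1 hc)]
    congr 2
    rw [eq_iff_iff]
    omega
  have h3 := (oddness_le_changes h2).trans (changes_le_add_one _ _)
  rw [ho] at h3
  unfold weight
  split_ifs at h0 <;> omega

theorem weight_one (n : ℕ) : weight (1 : SignedPerm n) = 0 := by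
  have hc (k : ℤ) : crossings (1 : SignedPerm n) k = 0 := by
    unfold crossings pairing
    refine Finset.sum_eq_zero fun x _ => ?_
    rw [show ((1 : SignedPerm n).1 x) = x from rfl]
    dsimp only
    split_ifs <;> omega
  have hN (k : ℤ) : negCount (1 : SignedPerm n) k = 0 := by
    unfold negCount pairing
    refine Finset.sum_eq_zero fun x _ => ?_
    rw [show ((1 : SignedPerm n).1 x) = x from rfl]
    dsimp only
    split_ifs <;> omega
  have ho := oddness_le_changes (w := (1 : SignedPerm n)) (ε := 0) fun k _ _ => by
    rw [hN, Int.cast_zero]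
    rfl
  have h0 : changes n 0 = 0 := by simp [changes]
  have hi : innerCrossings (1 : SignedPerm n) = 0 := Finset.sum_eq_zero fun k _ => hc k
  rw [weight, hc, hi]
  omega

theorem weight_mul_le {n : ℕ} (w : SignedPerm n) {β : Fin n → ℝ} {t : SignedPerm n}
    (hβ : β ∈ posRoots n) (ht : IsReflectionOf β t) :
    weight (w * t) ≤ weight w + 2 * (rootDepth β : ℤ) := by
  obtain ⟨p, q, hp, ⟨rfl, h⟩ | ⟨hpq, ⟨rfl, h⟩ | ⟨rfl, h⟩⟩⟩ := posRoot_cases hβ ht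
  · have := weight_mul_signChange_le w hp
    omega
  · have := weight_mul_refl_le w hp hpq
    omega
  · have := weight_mul_refl_neg_le w hp hpq
    omega

theorem weight_prod_le {n : ℕ} (F : List ((Fin n → ℝ) × SignedPerm n))
    (hF : ∀ p ∈ F, p.1 ∈ posRoots n ∧ IsReflectionOf p.1 p.2) :
    weight (F.map Prod.snd).prod ≤ 2 * ((F.map fun p => rootDepth p.1).sum : ℤ) := by
  induction F using List.reverseRecOn with
  | nil => simp [weight_one]
  | append_singleton F p ih =>
    have h1 := ih fun p' hp' => hF p' (List.mem_append_left _ hp')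
    obtain ⟨h2, h3⟩ := hF p (List.mem_append_right _ (List.mem_singleton_self p))
    have := weight_mul_le (F.map Prod.snd).prod h2 h3
    rw [List.map_append, List.prod_append, List.map_singleton, List.prod_singleton,
      List.map_append, List.sum_append, List.map_singleton, List.sum_singleton]
    push_cast at h1 ⊢
    omega

/-! ## Reflections lowering the weight by twice their depth -/

theorem innerCrossings_add_sum_le {n : ℕ} {u w : SignedPerm n} (c : ℕ → ℤ)
    (h : ∀ k : ℕ, crossings u k + c k ≤ crossings w k) :
    innerCrossings u + ∑ k ∈ Ico 1 n, c k ≤ innerCrossings w := by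
  rw [innerCrossings, innerCrossings, ← Finset.sum_add_distrib]
  exact Finset.sum_le_sum fun k _ => h k

/-- The conditions on `w(p)` and `w(q)` make one crossing disappear at every `k` in `[p, q)`, so the
upper estimate of `weight_mul_refl_le` is attained in reverse. -/
theorem weight_mul_refl_add_le {n : ℕ} {w : SignedPerm n} {p q : Idx n} (hp : 0 < p.1)
    (hpq : p.1 < q.1) (hwp : q.1 ≤ (w.1 p).1) (hwq : (w.1 q).1 ≤ p.1)
    (ho : oddness (w * refl p q) ≤ oddness w) :
    weight (w * refl p q) + 2 * (q.1 - p.1) ≤ weight w := by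
  have h0 := crossings_mul_refl w hp hpq (le_refl 0)
  rw [if_neg (by omega)] at h0
  have h1 := innerCrossings_add_sum_le (u := w * refl p q) (w := w)
    (fun k => if p.1 ≤ (k : ℤ) ∧ (k : ℤ) < q.1 then 1 else 0) fun k => by
      rw [crossings_mul_refl w hp hpq (by omega)]
      split_ifs <;> omega
  rw [sum_ite_le_and_lt hp hpq] at h1
  unfold weight
  omega

theorem weight_mul_refl_neg_add_le {n : ℕ} {w : SignedPerm n} {p q : Idx n} (hp : 0 < p.1)
    (hpq : p.1 < q.1) (hwp : (w.1 p).1 ≤ -q.1) (hwq : (w.1 q).1 ≤ -p.1)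
    (ho : oddness (w * refl p (-q)) ≤ oddness w) :
    weight (w * refl p (-q)) + 2 * (p.1 + q.1 - 1) ≤ weight w := by
  have h0 := crossings_mul_refl_neg w hp hpq (le_refl 0)
  have h1 := innerCrossings_add_sum_le (u := w * refl p (-q)) (w := w)
    (fun k => (if (k : ℤ) < p.1 then 1 else 0) + if (k : ℤ) < q.1 then 1 else 0) fun k => by
      rw [crossings_mul_refl_neg w hp hpq (by omega)]
      split_ifs <;> omega
  rw [Finset.sum_add_distrib, sum_ite_lt p hp, sum_ite_lt q (hp.trans hpq)] at h1
  unfold weight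
  split_ifs at h0 <;> omega

/-- The crossings account only for `1 + 2 (p - 1)`; the last unit of `2p` must come from a drop of
the oddness. -/
theorem weight_mul_signChange_add_le {n : ℕ} {w : SignedPerm n} {p : Idx n} (hp : 0 < p.1)
    (hwp : (w.1 p).1 ≤ -p.1) (ho : oddness (w * refl p (-p)) + 1 ≤ oddness w) :
    weight (w * refl p (-p)) + 2 * p.1 ≤ weight w := by
  have h0 := crossings_mul_signChange w hp (le_refl 0)
  have h1 := innerCrossings_add_sum_le (u := w * refl p (-p)) (w := w)
    (fun k => if (k : ℤ) < p.1 then 1 else 0) fun k => by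
      rw [crossings_mul_signChange w hp (by omega)]
      split_ifs <;> omega
  rw [sum_ite_lt p hp] at h1
  unfold weight
  split_ifs at h0 <;> omega

theorem negCount_eq_of_pos {n : ℕ} {w : SignedPerm n} {k m : ℤ} (hkm : k ≤ m)
    (h : ∀ x : Idx n, 0 < x.1 → k < x.1 → x.1 ≤ m → 0 < (w.1 x).1) :
    negCount w m = negCount w k := by
  unfold negCount pairing
  refine Finset.sum_congr rfl fun x _ => ?_
  dsimp only
  by_cases hx : 0 < x.1 ∧ k < x.1 ∧ x.1 ≤ m
  · rw [if_neg (not_lt.2 (h x hx.1 hx.2.1 hx.2.2).le), mul_zero, mul_zero]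
  · congr 2
    rw [eq_iff_iff]
    omega

theorem eq_of_not_cut {n : ℕ} {w : SignedPerm n} {ε : ℕ → ZMod 2}
    (hε : ∀ k : ℕ, 0 < k → k < n → ¬Cut w k → ε k = ε (k + 1)) {k m : ℕ} (hk : 0 < k)
    (hkm : k ≤ m) (hm : m ≤ n) (h : ∀ l : ℕ, k ≤ l → l < m → ¬Cut w l) : ε k = ε m := by
  induction m, hkm using Nat.le_induction with
  | base => rfl
  | succ m hkm ih =>
    rw [ih (by omega) fun l h1 h2 => h l h1 (by omega)]
    exact hε m (by omega) (by omega) (h m hkm (by omega))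

/-- Some positive root has a reflection lowering the weight by at least twice its depth. -/
def HasDescent {n : ℕ} (w : SignedPerm n) : Prop :=
  ∃ β ∈ posRoots n, ∃ t, IsReflectionOf β t ∧ t * t = 1 ∧
    weight (w * t) + 2 * (rootDepth β : ℤ) ≤ weight w

theorem hasDescent_of_refl {n : ℕ} {w : SignedPerm n} {p q : Idx n} (hp : 0 < p.1)
    (hpq : p.1 < q.1) (h : weight (w * refl p q) + 2 * (q.1 - p.1) ≤ weight w) :
    HasDescent w := by
  obtain ⟨r, hr, hd⟩ := exists_hasDepthLE_sub hp hpq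
  have := hd.rootDepth_le
  exact ⟨_, hd.mem_posRoots, _, hd.2.1, refl_mul_self _ _, by omega⟩

theorem hasDescent_of_refl_neg {n : ℕ} {w : SignedPerm n} {p q : Idx n} (hp : 0 < p.1)
    (hpq : p.1 < q.1) (h : weight (w * refl p (-q)) + 2 * (p.1 + q.1 - 1) ≤ weight w) :
    HasDescent w := by
  obtain ⟨r, hr, hd⟩ := exists_hasDepthLE_add hp hpq
  have := hd.rootDepth_le
  exact ⟨_, hd.mem_posRoots, _, hd.2.1, refl_mul_self _ _, by omega⟩

theorem hasDescent_of_signChange {n : ℕ} {w : SignedPerm n} {p : Idx n} (hp : 0 < p.1)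
    (h : weight (w * refl p (-p)) + 2 * p.1 ≤ weight w) : HasDescent w := by
  obtain ⟨r, hr, hd⟩ := exists_hasDepthLE_basisVec hp
  have := hd.rootDepth_le
  exact ⟨_, hd.mem_posRoots, _, hd.2.1, refl_mul_self _ _, by omega⟩

/-- If `w i > i` is the largest entry exceeding its position, then some position in `(i, w i]` has
an entry `≤ i`. -/
theorem exists_apply_le {n : ℕ} {w : SignedPerm n} {i : Idx n} (hi : 0 < i.1)
    (hmax : ∀ y : Idx n, 0 < y.1 → y.1 < (w.1 y).1 → (w.1 y).1 ≤ (w.1 i).1)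
    (hiw : i.1 < (w.1 i).1) :
    ∃ y : Idx n, i.1 < y.1 ∧ y.1 ≤ (w.1 i).1 ∧ (w.1 y).1 ≤ i.1 := by
  classical
  by_contra! hcon
  -- If all entries on `(i, w(i)]` exceeded `i`, maximality would keep them at most `w(i)`, and `w`
  -- would inject `[i, w(i)]` into `(i, w(i)]`.
  let S : Finset (Idx n) := univ.filter fun y => i.1 ≤ y.1 ∧ y.1 ≤ (w.1 i).1
  let T : Finset (Idx n) := univ.filter fun y => i.1 < y.1 ∧ y.1 ≤ (w.1 i).1
  have hT : T ⊂ S := by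
    refine Finset.ssubset_iff_subset_ne.2 ⟨fun y hy => ?_, fun e => ?_⟩
    · simp only [S, T, Finset.mem_filter] at hy ⊢
      exact ⟨hy.1, hy.2.1.le, hy.2.2⟩
    · have : i ∈ T := e ▸ Finset.mem_filter.2 ⟨Finset.mem_univ i, le_refl _, hiw.le⟩
      exact lt_irrefl _ (Finset.mem_filter.1 this).2.1
  refine absurd (Finset.card_le_card_of_injOn w.1 (s := S) (t := T) ?_ w.1.injective.injOn)
    (not_le.2 (Finset.card_lt_card hT))
  intro y hy
  obtain ⟨-, h1, h2⟩ := Finset.mem_filter.1 hy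
  refine Finset.mem_filter.2 ⟨Finset.mem_univ _, ?_, ?_⟩
  · rcases h1.lt_or_eq with h | h
    · exact hcon y h h2
    · rwa [← Subtype.ext h]
  · by_contra hc
    exact hc (hmax y (by omega) (by omega))

/-- Let `w(i)` be the largest entry exceeding its position and `w(j)` the smallest entry on `(i,
w(i)]`. The crossings drop as required, so the point is that the exchange does not raise the
oddness: an optimal `ε` for `w` remains adapted. -/
theorem hasDescent_of_exceedance {n : ℕ} {w : SignedPerm n}
    (h : ∃ x : Idx n, 0 < x.1 ∧ x.1 < (w.1 x).1) : HasDescent w := by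
  classical
  obtain ⟨i, hi, hmax⟩ := Finset.exists_max_image
    (univ.filter fun x : Idx n => 0 < x.1 ∧ x.1 < (w.1 x).1) (fun x => (w.1 x).1)
    (by obtain ⟨x, hx⟩ := h; exact ⟨x, Finset.mem_filter.2 ⟨Finset.mem_univ x, hx⟩⟩)
  obtain ⟨-, hi0, hiw⟩ := Finset.mem_filter.1 hi
  replace hmax (y : Idx n) (h1 : 0 < y.1) (h2 : y.1 < (w.1 y).1) : (w.1 y).1 ≤ (w.1 i).1 :=
    hmax y (Finset.mem_filter.2 ⟨Finset.mem_univ y, h1, h2⟩)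
  obtain ⟨y₀, hy1, hy2, hy3⟩ := exists_apply_le hi0 hmax hiw
  obtain ⟨j, hj, hmin⟩ := Finset.exists_min_image
    (univ.filter fun y : Idx n => i.1 < y.1 ∧ y.1 ≤ (w.1 i).1) (fun y => (w.1 y).1)
    ⟨y₀, Finset.mem_filter.2 ⟨Finset.mem_univ _, hy1, hy2⟩⟩
  obtain ⟨-, hij, hjw⟩ := Finset.mem_filter.1 hj
  replace hmin (y : Idx n) (h1 : i.1 < y.1) (h2 : y.1 ≤ (w.1 i).1) : (w.1 j).1 ≤ (w.1 y).1 :=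
    hmin y (Finset.mem_filter.2 ⟨Finset.mem_univ y, h1, h2⟩)
  have hwj : (w.1 j).1 ≤ i.1 := (hmin y₀ hy1 hy2).trans hy3
  refine hasDescent_of_refl hi0 hij (weight_mul_refl_add_le hi0 hij hjw hwj ?_)
  obtain ⟨ε, hε, ho, hconst⟩ := exists_changes_eq_oddness w
  have hadapt : Adapted (w * refl i j) ε := by
    intro k hk hc
    have hcut (m : ℤ) (hm : ¬(i.1 ≤ m ∧ m < j.1)) : Cut (w * refl i j) m ↔ Cut w m := by
      refine cut_mul_refl ?_
      rw [abs_of_pos hi0, abs_of_pos (hi0.trans hij)]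
      omega
    have hneg (m : ℤ) (hm : ¬(i.1 ≤ m ∧ m < j.1)) :
        negCount (w * refl i j) m = negCount w m := by
      rw [negCount_mul_refl w hi0 hij, if_neg hm, add_zero]
    by_cases hk' : i.1 ≤ (k : ℤ) ∧ (k : ℤ) < j.1
    · have hwj' := hc i (by rw [abs_of_pos hi0]; exact hk'.1)
      rw [mul_refl_left, abs_le] at hwj'
      -- At a new cut `k`, entries beyond `k` have absolute value above `k`, whereas those on `(k,
      -- w(i)]` coming from `w` are at least `w(j) ≥ -k`. Hence they are positive, and the
      -- maximality of `w(i)` bounds them above.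
      have hpos (y : Idx n) (h1 : (k : ℤ) < y.1) (h2 : y.1 ≤ (w.1 i).1) :
          0 < ((w * refl i j).1 y).1 ∧ ((w * refl i j).1 y).1 ≤ (w.1 i).1 := by
        by_cases hyj : y = j
        · rw [hyj, mul_refl_right]
          omega
        · have hyj' : y.1 ≠ j.1 := fun e => hyj (Subtype.ext e)
          have h3 := hc.lt_abs (x := y) (by rw [abs_of_pos (by omega)]; exact h1)
          rw [mul_refl_of_ne w (by rw [abs_of_pos hi0, abs_of_pos (by omega)]; omega)
            (by rw [abs_of_pos (hi0.trans hij), abs_of_pos (by omega)]; exact hyj')] at h3 ⊢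
          have h4 := hmin y (by omega) h2
          rcases lt_abs.1 h3 with h5 | h5
          · refine ⟨by omega, ?_⟩
            by_contra h6
            exact h6 (hmax y (by omega) (by omega))
          · omega
      obtain ⟨m, hm⟩ := Int.eq_ofNat_of_zero_le (hi0.trans hiw).le
      have hcm : Cut w m := by
        refine (hcut m (by omega)).1 fun y hy => ?_
        rw [abs_le] at hy
        by_cases hyk : |y.1| ≤ k
        · exact (hc y hyk).trans (by omega)
        · rcases lt_or_gt_of_ne (idx_ne_zero y) with h0 | h0
          · rw [abs_of_neg h0] at hyk
            have := hpos (-y) (by rw [neg_val]; omega) (by rw [neg_val]; omega)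
            rw [map_neg, neg_val] at this
            rw [abs_le]
            omega
          · rw [abs_of_pos h0] at hyk
            have := hpos y (by omega) (by omega)
            rw [abs_le]
            omega
      have hmn : m ≤ n := by
        have := idx_le (w.1 i)
        omega
      -- With `m = w(i)`, no `l` in `[k, m)` is a cut of `w`, since `i ≤ l < w(i)`. So `ε k = ε m`;
      -- and no negative entry lies between `k` and `m` after the exchange, so this is the required
      -- parity at `k`.
      rw [eq_of_not_cut hconst (show 0 < k by omega) (show k ≤ m by omega) hmn
        fun l h1 h2 hcl => ?_, hε m hmn hcm, ← hneg m (by omega),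
        negCount_eq_of_pos (show (k : ℤ) ≤ m by omega) fun y _ h1 h2 => (hpos y h1 (by omega)).1]
      have := (abs_le.1 (hcl i (by rw [abs_of_pos hi0]; omega))).2
      omega
    · rw [hneg k hk', hε k hk ((hcut k hk').1 hc)]
  have := oddness_le_changes hadapt
  omega

theorem eq_one_of_pos_of_le {n : ℕ} {w : SignedPerm n}
    (h : ∀ x : Idx n, 0 < x.1 → 0 < (w.1 x).1 ∧ (w.1 x).1 ≤ x.1) : w = 1 := by
  have key (m : ℕ) : ∀ x : Idx n, 0 < x.1 → x.1 = m → w.1 x = x := by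
    induction m using Nat.strong_induction_on with
    | _ m ih =>
      intro x hx hxm
      obtain ⟨h1, h2⟩ := h x hx
      by_contra hne
      have hlt : (w.1 x).1 < x.1 := lt_of_le_of_ne h2 fun e => hne (Subtype.ext e)
      exact hne (w.1.injective (ih (w.1 x).1.toNat (by omega) (w.1 x) h1 (by omega)))
  refine Subtype.ext (Equiv.ext fun x => ?_)
  rcases lt_or_gt_of_ne (idx_ne_zero x) with h0 | h0
  · have hx : 0 < (-x).1 := by rw [neg_val]; omega
    have := key (-x).1.toNat (-x) hx (by omega)
    rw [map_neg] at this
    rw [← neg_neg_idx (w.1 x), this, neg_neg_idx]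
    rfl
  · exact key x.1.toNat x h0 (by omega)

theorem changes_add_one_le {n m : ℕ} (hm : m < n) {ε : ℕ → ZMod 2} (h : ε m ≠ ε (m + 1)) :
    changes n (fun k => ε k + if m < k then 1 else 0) + 1 ≤ changes n ε := by
  have hsum : (∑ k ∈ range n, if k = m then (1 : ℤ) else 0) = 1 := by
    rw [Finset.sum_ite_eq', if_pos (Finset.mem_range.2 hm)]
  have h' : ε m = ε (m + 1) + 1 := by
    revert h
    generalize ε m = a
    generalize ε (m + 1) = b
    revert a b
    decide
  rw [← hsum, changes, changes, ← Finset.sum_add_distrib]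
  refine Finset.sum_le_sum fun k _ => ?_
  rcases lt_trichotomy k m with hk | rfl | hk
  · simp only [if_neg (not_lt.2 hk.le), if_neg (show ¬m < k + 1 by omega), if_neg hk.ne,
      add_zero, le_refl]
  · simp [h']
  · simp only [if_pos hk, if_pos (hk.trans (Nat.lt_succ_self k)), add_left_inj, if_neg hk.ne',
      add_zero, le_refl]

/-- Let `w(i) = -m` be the smallest entry. Without exceedances `m` is a cut; with `p` the last cut
before `m`, the positions `(p, m]` form the block of `i`. The parity of its negative entries decides
between a sign change and a double sign change. -/
theorem hasDescent_of_no_exceedance {n : ℕ} {w : SignedPerm n} (hw : w ≠ 1)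
    (hno : ∀ x : Idx n, 0 < x.1 → (w.1 x).1 ≤ x.1) : HasDescent w := by
  classical
  obtain ⟨x, hx0, hxneg⟩ : ∃ x : Idx n, 0 < x.1 ∧ (w.1 x).1 < 0 := by
    by_contra! hcon
    exact hw (eq_one_of_pos_of_le fun x hx =>
      ⟨lt_of_le_of_ne (hcon x hx) (idx_ne_zero _).symm, hno x hx⟩)
  obtain ⟨i, hi, hmin⟩ := Finset.exists_min_image (univ.filter fun x : Idx n => 0 < x.1)
    (fun x => (w.1 x).1) ⟨x, Finset.mem_filter.2 ⟨Finset.mem_univ x, hx0⟩⟩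
  have hi0 : 0 < i.1 := (Finset.mem_filter.1 hi).2
  replace hmin (y : Idx n) (hy : 0 < y.1) : (w.1 i).1 ≤ (w.1 y).1 :=
    hmin y (Finset.mem_filter.2 ⟨Finset.mem_univ y, hy⟩)
  have hiw : (w.1 i).1 < 0 := (hmin x hx0).trans_lt hxneg
  obtain ⟨m, hm⟩ := Int.eq_ofNat_of_zero_le (show 0 ≤ -(w.1 i).1 by omega)
  have hmn : m ≤ n := by
    have := neg_le_idx (w.1 i)
    omega
  have hcm : Cut w m := by
    intro y hy
    rw [abs_le] at hy ⊢
    rcases lt_or_gt_of_ne (idx_ne_zero y) with h0 | h0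
    · have h1 := hno (-y) (by rw [neg_val]; omega)
      have h2 := hmin (-y) (by rw [neg_val]; omega)
      rw [map_neg, neg_val] at h1 h2
      rw [neg_val] at h1
      omega
    · have h1 := hno y h0
      have h2 := hmin y h0
      omega
  have him : i.1 ≤ m := by
    by_contra hc
    have := hcm.lt_abs (x := i) (by rw [abs_of_pos hi0]; omega)
    rw [abs_of_neg hiw] at this
    omega
  obtain ⟨p, hpm, hcp, hbetween⟩ : ∃ p : ℕ, p < m ∧ Cut w p ∧
      ∀ l : ℕ, p < l → l < m → ¬Cut w l := by
    refine ⟨Nat.findGreatest (fun k => Cut w k) (m - 1), ?_, ?_, fun l h1 h2 => ?_⟩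
    · have := Nat.findGreatest_le (P := fun k : ℕ => Cut w k) (m - 1)
      omega
    · exact Nat.findGreatest_spec (P := fun k : ℕ => Cut w k) (Nat.zero_le _) (cut_zero w)
    · exact Nat.findGreatest_is_greatest h1 (by omega)
  have hpi : (p : ℤ) < i.1 := by
    by_contra hc
    have := hcp i (by rw [abs_of_pos hi0]; omega)
    rw [abs_of_neg hiw] at this
    omega
  obtain ⟨ε, hε, ho, hconst⟩ := exists_changes_eq_oddness w
  have hconst' (k : ℕ) (h1 : p < k) (h2 : k ≤ m) : ε k = ε m :=
    eq_of_not_cut hconst (by omega) h2 hmn fun l h3 h4 => hbetween l (by omega) h4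
  by_cases hpar : ε p = ε m
  · have hother : ∃ y : Idx n, 0 < y.1 ∧ (p : ℤ) < y.1 ∧ y ≠ i ∧ (w.1 y).1 < 0 := by
      by_contra! hcon
      have h1 : negCount (w * refl i (-i)) m = negCount (w * refl i (-i)) p := by
        refine negCount_eq_of_pos (by omega) fun y h0 h1 _ => ?_
        by_cases hyi : y = i
        · rw [hyi, mul_refl_left, map_neg, neg_val]
          omega
        · have hyi' : y.1 ≠ i.1 := fun e => hyi (Subtype.ext e)
          rw [mul_refl_of_ne w (by rw [abs_of_pos h0, abs_of_pos hi0]; exact hyi')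
            (by rw [neg_val, abs_neg, abs_of_pos h0, abs_of_pos hi0]; exact hyi')]
          exact lt_of_le_of_ne (hcon y h0 h1 hyi) (idx_ne_zero _).symm
      have h2 := congrArg (Int.cast (R := ZMod 2)) h1
      rw [negCount_mul_signChange_cast w hi0, negCount_mul_signChange_cast w hi0, if_pos him,
        if_neg (by omega), ← hε m hmn hcm, ← hε p (by omega) hcp, hpar] at h2
      simp at h2
    obtain ⟨y, hy0, hpy, hyi, hyneg⟩ := hother
    obtain ⟨j, hj, hmin'⟩ := Finset.exists_min_image
      (univ.filter fun x : Idx n => 0 < x.1 ∧ x ≠ i) (fun x => (w.1 x).1)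
      ⟨y, Finset.mem_filter.2 ⟨Finset.mem_univ y, hy0, hyi⟩⟩
    obtain ⟨-, hj0, hji⟩ := Finset.mem_filter.1 hj
    replace hmin' (y : Idx n) (h1 : 0 < y.1) (h2 : y ≠ i) : (w.1 j).1 ≤ (w.1 y).1 :=
      hmin' y (Finset.mem_filter.2 ⟨Finset.mem_univ y, h1, h2⟩)
    have hji' : j.1 ≠ i.1 := fun e => hji (Subtype.ext e)
    have hjw : (w.1 j).1 < 0 := (hmin' y hy0 hyi).trans_lt hyneg
    -- If `i = p + 1`, the cut at `p` gives `w(y) ≤ -i`. Otherwise `i - 1` is not a cut, so some `z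
    -- < i` has `|w(z)| ≥ i`, and this entry is negative because there are no exceedances. In both
    -- cases `w(j)` is at most the entry found.
    have hwji : (w.1 j).1 ≤ -i.1 := by
      by_cases hpi' : (p : ℤ) + 1 = i.1
      · have h1 := hcp.lt_abs (x := y) (by rw [abs_of_pos hy0]; exact hpy)
        rw [abs_of_neg hyneg] at h1
        have := hmin' y hy0 hyi
        omega
      · have h1 := hbetween (i.1 - 1).toNat (by omega) (by omega)
        obtain ⟨z, hz0, hz1, hz2⟩ : ∃ z : Idx n, 0 < z.1 ∧ z.1 ≤ i.1 - 1 ∧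
            i.1 - 1 < |(w.1 z).1| := by
          simp only [Cut, not_forall, not_le] at h1
          obtain ⟨z, hz1, hz2⟩ := h1
          rw [Int.toNat_of_nonneg (by omega)] at hz1 hz2
          rcases lt_or_gt_of_ne (idx_ne_zero z) with h0 | h0
          · rw [abs_of_neg h0] at hz1
            refine ⟨-z, ?_, ?_, ?_⟩
            · rw [neg_val]; omega
            · rw [neg_val]; omega
            · rwa [map_neg, neg_val, abs_neg]
          · rw [abs_of_pos h0] at hz1
            exact ⟨z, h0, hz1, hz2⟩
        have h3 := hno z hz0
        have h4 := hmin' z hz0 fun e => by rw [e] at hz1; omega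
        rcases lt_abs.1 hz2 with h5 | h5 <;> omega
    have hjm : j.1 ≤ m := by
      by_contra hc
      have h1 := hcm.lt_abs (x := j) (by rw [abs_of_pos hj0]; omega)
      rw [abs_of_neg hjw] at h1
      have := hmin j hj0
      omega
    rcases lt_or_gt_of_ne hji' with hlt | hlt
    · refine hasDescent_of_refl_neg hj0 hlt
        (weight_mul_refl_neg_add_le hj0 hlt hwji (by omega) ?_)
      have hadapt : Adapted (w * refl j (-i)) ε := by
        intro k hk hc
        by_cases hk' : j.1 ≤ (k : ℤ) ∧ (k : ℤ) < i.1
        · have h1 := hc j (by rw [abs_of_pos hj0]; exact hk'.1)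
          rw [mul_refl_left, map_neg, neg_val, abs_neg, abs_of_neg hiw] at h1
          omega
        · rw [negCount_mul_refl_neg_cast w hj0 hlt (by omega)]
          refine hε k hk ((cut_mul_refl ?_).1 hc)
          rw [neg_val, abs_neg, abs_of_pos hj0, abs_of_pos hi0]
          omega
      have := oddness_le_changes hadapt
      omega
    · refine hasDescent_of_refl_neg hi0 hlt
        (weight_mul_refl_neg_add_le hi0 hlt (by omega) hwji ?_)
      have hadapt : Adapted (w * refl i (-j)) ε := by
        intro k hk hc
        by_cases hk' : i.1 ≤ (k : ℤ) ∧ (k : ℤ) < j.1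
        · have h1 := hc i (by rw [abs_of_pos hi0]; exact hk'.1)
          rw [mul_refl_left, map_neg, neg_val, abs_neg, abs_of_neg hjw] at h1
          -- A cut `k` in `[i, j)` forces `-w(j) ≤ k`. As `w(j)` is the second smallest entry, all
          -- entries beyond `k` are now positive, so the parity at `k` equals that at `m`, and `ε`
          -- is constant on `(p, m]`.
          rw [← negCount_eq_of_pos (show (k : ℤ) ≤ m by omega),
            negCount_mul_refl_neg_cast w hi0 hlt (Or.inr hjm), hconst' k (by omega) (by omega),
            hε m hmn hcm]
          intro z hz0 hz1 _
          by_cases hzj : z = j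
          · rw [hzj, ← neg_neg_idx j, map_neg, neg_neg_idx, mul_refl_right, neg_val]
            omega
          · have hzj' : z.1 ≠ j.1 := fun e => hzj (Subtype.ext e)
            have hzi' : z ≠ i := fun e => by rw [e] at hz1; omega
            have h2 := hc.lt_abs (x := z) (by rw [abs_of_pos hz0]; exact hz1)
            rw [mul_refl_of_ne w (by rw [abs_of_pos hz0, abs_of_pos hi0]; omega)
              (by rw [neg_val, abs_neg, abs_of_pos hz0, abs_of_pos hj0]; exact hzj')] at h2 ⊢
            have h3 := hmin' z hz0 hzi'
            rcases lt_abs.1 h2 with h5 | h5 <;> omega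
        · rw [negCount_mul_refl_neg_cast w hi0 hlt (by omega)]
          refine hε k hk ((cut_mul_refl ?_).1 hc)
          rw [neg_val, abs_neg, abs_of_pos hj0, abs_of_pos hi0]
          omega
      have := oddness_le_changes hadapt
      omega
  · refine hasDescent_of_signChange hi0 (weight_mul_signChange_add_le hi0 (by omega) ?_)
    -- The parity flips from `i` on, but no cut lies strictly between `p` and `m`, so at cuts the
    -- flip may be placed right after `p`. There it cancels the change of `ε` belonging to the odd
    -- block.
    have hadapt : Adapted (w * refl i (-i)) (fun k => ε k + if p < k then 1 else 0) := by
      intro k hk hc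
      have hck := cut_mul_signChange.1 hc
      simp only
      rw [negCount_mul_signChange_cast w hi0, hε k hk hck]
      congr 2
      rw [eq_iff_iff]
      constructor
      · intro h1
        by_contra h2
        exact hbetween k h1 (by omega) hck
      · intro h1
        omega
    have h1 := oddness_le_changes hadapt
    have h2 := changes_add_one_le (show p < n by omega)
      (show ε p ≠ ε (p + 1) by rwa [hconst' (p + 1) (by omega) (by omega)])
    omega

theorem hasDescent {n : ℕ} {w : SignedPerm n} (hw : w ≠ 1) : HasDescent w := by
  by_cases h : ∃ x : Idx n, 0 < x.1 ∧ x.1 < (w.1 x).1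
  · exact hasDescent_of_exceedance h
  · push Not at h
    exact hasDescent_of_no_exceedance hw h

/-! ## The depth is half of the weight -/

theorem weight_nonneg {n : ℕ} (w : SignedPerm n) : 0 ≤ weight w := by
  have h (k : ℤ) : 0 ≤ crossings w k := by
    unfold crossings pairing
    refine Finset.sum_nonneg fun x _ => mul_nonneg ?_ ?_ <;> dsimp only <;> split_ifs <;> norm_num
  have := h 0
  have : 0 ≤ innerCrossings w := Finset.sum_nonneg fun k _ => h k
  unfold weight
  omega

theorem rootDepth_pos {n : ℕ} {β : Fin n → ℝ} (hβ : β ∈ posRoots n) : 0 < rootDepth β := by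
  obtain ⟨t, ht⟩ := exists_isReflectionOf hβ.1
  obtain ⟨p, q, hp, h⟩ := posRoot_cases hβ ht
  omega

/-- Descents are iterated; the weight drops strictly because positive roots have positive depth
(`rootDepth_pos`). -/
theorem exists_factorization {n : ℕ} (w : SignedPerm n) :
    ∃ F : List ((Fin n → ℝ) × SignedPerm n),
      (∀ p ∈ F, p.1 ∈ posRoots n ∧ IsReflectionOf p.1 p.2) ∧ (F.map Prod.snd).prod = w ∧
        2 * ((F.map fun p => rootDepth p.1).sum : ℤ) ≤ weight w := by
  obtain ⟨N, hN⟩ := Int.eq_ofNat_of_zero_le (weight_nonneg w)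
  induction N using Nat.strong_induction_on generalizing w with
  | _ N ih =>
    by_cases hw : w = 1
    · exact ⟨[], by simp, hw.symm, by simpa using weight_nonneg w⟩
    · obtain ⟨β, hβ, t, ht, htt, hle⟩ := hasDescent hw
      have hd := rootDepth_pos hβ
      have h0 := weight_nonneg (w * t)
      obtain ⟨F, hF, hprod, hsum⟩ := ih (weight (w * t)).toNat (by omega) (w * t) (by omega)
      refine ⟨F ++ [(β, t)], fun p hp => ?_, ?_, ?_⟩
      · rcases List.mem_append.1 hp with hp | hp
        · exact hF p hp
        · rw [List.mem_singleton.1 hp]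
          exact ⟨hβ, ht⟩
      · rw [List.map_append, List.prod_append, hprod, List.map_singleton, List.prod_singleton,
          mul_assoc, htt, mul_one]
      · rw [List.map_append, List.sum_append, List.map_singleton, List.sum_singleton]
        push_cast at hsum ⊢
        omega

theorem two_mul_depth {n : ℕ} (w : SignedPerm n) : 2 * (depth w : ℤ) = weight w := by
  obtain ⟨F, hF, hprod, hsum⟩ := exists_factorization w
  refine le_antisymm (le_trans ?_ hsum) ?_
  · have : depth w ≤ (F.map fun p => rootDepth p.1).sum := Nat.sInf_le ⟨F, hF, hprod, rfl⟩
    omega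
  -- The factorization `F` shows that the set is nonempty, so that its `sInf` is attained and is not
  -- the default value `0`.
  · obtain ⟨G, hG, hGprod, hGsum⟩ := Nat.sInf_mem (s := {d | ∃ F : List ((Fin n → ℝ) ×
      SignedPerm n), (∀ p ∈ F, p.1 ∈ posRoots n ∧ IsReflectionOf p.1 p.2) ∧
      (F.map Prod.snd).prod = w ∧ (F.map fun p => rootDepth p.1).sum = d})
      ⟨_, F, hF, hprod, rfl⟩
    have := weight_prod_le G hG
    rw [hGprod, hGsum] at this
    exact this

/-! ## The weight in terms of the entries -/

theorem crossings_zero {n : ℕ} (w : SignedPerm n) : crossings w 0 = neg w := by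
  rw [crossings, pairing, sum_idx, neg, negSet, Finset.card_filter]
  push_cast
  rw [Finset.sum_eq_zero (s := univ) (f := fun i : Fin n =>
    (if (pos i).1 ≤ 0 then (1 : ℤ) else 0) * _), zero_add]
  · refine Finset.sum_congr rfl fun i _ => ?_
    rw [if_pos (by rw [neg_val, pos_val]; omega), one_mul, map_neg, neg_val]
    simp only [window]
    split_ifs <;> omega
  · intro i _
    rw [if_neg (by rw [pos_val]; omega), zero_mul]

theorem sum_range_ite_lt (n : ℕ) (b : ℤ) :
    ∑ k ∈ range n, (if (k : ℤ) < b then 1 else 0 : ℤ) = min (n : ℤ) (max b 0) := by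
  induction n with
  | zero => simp
  | succ n ih =>
    rw [Finset.sum_range_succ, ih]
    split_ifs <;> omega

theorem sum_range_ite_le_and_lt (n : ℕ) (a b : ℤ) :
    ∑ k ∈ range n, (if a ≤ k ∧ (k : ℤ) < b then 1 else 0 : ℤ) =
      min (n : ℤ) (max b 0) - min (n : ℤ) (max (min a b) 0) := by
  rw [← sum_range_ite_lt, ← sum_range_ite_lt, ← Finset.sum_sub_distrib]
  exact Finset.sum_congr rfl fun k _ => by split_ifs <;> omega

theorem sum_upward_eq_crossings {n : ℕ} (w : SignedPerm n) (k : ℤ) :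
    ∑ x, (if x.1 ≤ k ∧ k < (w.1 x).1 then 1 else 0 : ℤ) = crossings w k := by
  unfold crossings pairing
  refine Finset.sum_congr rfl fun x _ => ?_
  dsimp only
  split_ifs <;> omega

/-- After `x ↦ -x` this counts the `x > k` with `w(x) ≤ k`. There are as many of these as upward
crossings, because the bijection `w` leaves the number of indices `≤ k` unchanged. -/
theorem sum_downward_eq_crossings {n : ℕ} (w : SignedPerm n) (k : ℤ) :
    ∑ x, (if -(w.1 x).1 ≤ k ∧ k < -x.1 then 1 else 0 : ℤ) = crossings w k := by
  rw [← sum_upward_eq_crossings,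
    ← Equiv.sum_comp (Function.Involutive.toPerm (fun x : Idx n => -x) neg_neg_idx)]
  have h := Equiv.sum_comp w.1 fun x => if x.1 ≤ k then (1 : ℤ) else 0
  rw [← sub_eq_zero, ← Finset.sum_sub_distrib] at h ⊢
  refine Eq.trans (Finset.sum_congr rfl fun x _ => ?_) h
  rw [show Function.Involutive.toPerm (fun x : Idx n => -x) neg_neg_idx x = -x from rfl, map_neg,
    neg_val, neg_val, neg_neg, neg_neg]
  split_ifs <;> omega

/-- The length of `[x, w(x))` counts its integers. The nonnegative ones are upward crossings; the
negative ones become, under `k ↦ -k - 1`, the mirrored crossings with `-w(x) ≤ k < -x`. -/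
theorem sum_exceedances {n : ℕ} (w : SignedPerm n) :
    ∑ x : Idx n with x.1 < (w.1 x).1, ((w.1 x).1 - x.1) =
      2 * (crossings w 0 + innerCrossings w) := by
  have h1 (x : Idx n) : (if x.1 < (w.1 x).1 then (w.1 x).1 - x.1 else 0) =
      ∑ k ∈ range n, ((if x.1 ≤ k ∧ (k : ℤ) < (w.1 x).1 then 1 else 0) +
        if -(w.1 x).1 ≤ k ∧ (k : ℤ) < -x.1 then 1 else 0) := by
    rw [Finset.sum_add_distrib, sum_range_ite_le_and_lt, sum_range_ite_le_and_lt]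
    have := idx_le x
    have := neg_le_idx x
    have := idx_le (w.1 x)
    have := neg_le_idx (w.1 x)
    split_ifs <;> omega
  rw [Finset.sum_filter, Finset.sum_congr rfl fun x _ => h1 x, Finset.sum_comm]
  simp only [Finset.sum_add_distrib, sum_upward_eq_crossings, sum_downward_eq_crossings]
  rcases Nat.eq_zero_or_pos n with rfl | hn
  · simp [innerCrossings, crossings_zero, neg, negSet]
  · rw [Finset.range_eq_Ico, Finset.sum_eq_sum_Ico_succ_bot hn, Nat.cast_zero, innerCrossings]
    ring

theorem sum_abs_window {n : ℕ} (w : SignedPerm n) :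
    ∑ i, |window w i| = ∑ i : Fin n, (pos i).1 := by
  have h := Equiv.sum_comp w.1 fun x => |x.1|
  rw [sum_idx, sum_idx] at h
  simp only [map_neg, neg_val, abs_neg] at h
  have h2 : ∑ i : Fin n, |(pos i).1| = ∑ i : Fin n, (pos i).1 :=
    Finset.sum_congr rfl fun i _ => abs_of_pos (by rw [pos_val]; omega)
  rw [h2] at h
  unfold window
  omega

/-- Combining the terms of `i` and `-i`, the two sides differ at each `i` by `i - |w(i)|`, and these
differences sum to zero since `|w|` permutes `1, …, n`. -/
theorem sum_exceedances_eq {n : ℕ} (w : SignedPerm n) :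
    ∑ x : Idx n with x.1 < (w.1 x).1, ((w.1 x).1 - x.1) =
      2 * (∑ i : Fin n with (pos i).1 < window w i, (window w i - (pos i).1) +
        ∑ i ∈ negSet w, |window w i|) := by
  have h := (sum_abs_window w).symm
  rw [← sub_eq_zero, ← Finset.sum_sub_distrib] at h
  rw [Finset.sum_filter, sum_idx, negSet, Finset.sum_filter, Finset.sum_filter,
    ← Finset.sum_add_distrib, ← Finset.sum_add_distrib, Finset.mul_sum, ← sub_eq_zero,
    ← Finset.sum_sub_distrib]
  refine Eq.trans (Finset.sum_congr rfl fun i _ => ?_) h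
  simp only [map_neg, neg_val, window]
  rcases abs_cases (w.1 (pos i)).1 with ⟨h1, h2⟩ | ⟨h1, h2⟩ <;> rw [h1] <;> split_ifs <;> omega

end TypeB

theorem theorem2p3 (n : ℕ) (w : TypeB.SignedPerm n) :
    (TypeB.depth w : ℚ) =
        (∑ i : Fin n with (TypeB.pos i).1 < TypeB.window w i,
            ((TypeB.window w i : ℚ) - ((TypeB.pos i).1 : ℚ)))
          + (∑ i ∈ TypeB.negSet w, |(TypeB.window w i : ℚ)|)
          + ((TypeB.oddness w : ℚ) - (TypeB.neg w : ℚ)) / 2 ∧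
    (TypeB.depth w : ℚ) =
        (1 / 2 : ℚ) * ((∑ x : TypeB.Idx n with x.1 < (w.1 x).1, (((w.1 x).1 : ℚ) - (x.1 : ℚ)))
          + (TypeB.oddness w : ℚ) - (TypeB.neg w : ℚ)) := by
  have h1 := TypeB.two_mul_depth w
  have h2 := TypeB.sum_exceedances w
  have h3 := TypeB.sum_exceedances_eq w
  rw [TypeB.weight, TypeB.crossings_zero] at h1
  rw [TypeB.crossings_zero] at h2
  have h1' := congrArg (Int.cast (R := ℚ)) h1
  have h2' := congrArg (Int.cast (R := ℚ)) h2
  have h3' := congrArg (Int.cast (R := ℚ)) h3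
  push_cast at h1' h2' h3'
  constructor <;> linarith
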